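/- Let $\Bbbk$ be an algebraically closed field of characteristic zero and let $\mathfrak g$ be a finite-dimensional semisimple Lie algebra over $\Bbbk$, of rank $\ell$. For a finite-dimensional Lie algebra $\mathfrak a$ over $\Bbbk$ and $f\in\mathfrak a^*$, put $\mathfrak a^{(f)}=\{x\in\mathfrak a : f([x,y])=0 \text{ for all } y\in\mathfrak a\}$; the index of $\mathfrak a$ is $\chi(\mathfrak a)=\min\{\dim \mathfrak a^{(f)} : f\in\mathfrak a^*\}$. A subalgebra of $\mathfrak g$ is called parabolic if it contains a Borel subalgebra, that is, a subalgebra of the form $\mathfrak h\oplus\bigoplus_{\alpha\in R_+}\mathfrak g^\alpha$, where $\mathfrak h$ is a Cartan subalgebra of $\mathfrak g$ and $R_+$ is the set of positive roots of $(\mathfrak g,\mathfrak h)$ with respect to some base of the root system. Then for every integer $i$ with $0\le i\le \ell$ there exists a parabolic subalgebra $\mathfrak p$ of $\mathfrak g$ such that $\chi(\mathfrak p)=i$. -/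

import Mathlib

namespace LieIndex

open Module LieAlgebra

/-- The alternating bilinear form `Φ_f (x, y) = f ⁅x, y⁆` on `L` attached to a linear form `f`. -/
def coadjointForm {k L : Type*} [Field k] [LieRing L] [LieAlgebra k L] (f : Dual k L) :
    LinearMap.BilinForm k L :=
  LinearMap.mk₂ k (fun x y => f ⁅x, y⁆)
    (fun x y z => by simp) (fun c x y => by simp)
    (fun x y z => by simp) (fun c x y => by simp)

/-- The index of a finite-dimensional Lie algebra: the least dimension of the kernel of the
form `Φ_f`, as `f` ranges over the linear forms on `L`. -/
noncomputable def index (k L : Type*) [Field k] [LieRing L] [LieAlgebra k L] : ℕ :=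
  ⨅ f : Dual k L, finrank k (LinearMap.ker (coadjointForm f))

section

variable {k L : Type*} [Field k] [CharZero k] [IsAlgClosed k] [LieRing L] [LieAlgebra k L]
  [FiniteDimensional k L] [IsKilling k L]

/-- A Borel subalgebra: the sum of a Cartan subalgebra `H` and of the root spaces of the roots
that are positive with respect to some base of the root system of `(L, H)`. -/
def IsBorel (b : LieSubalgebra k L) : Prop :=
  ∃ (H : LieSubalgebra k L) (_ : H.IsCartanSubalgebra) (B : (IsKilling.rootSystem H).Base),
    b.toSubmodule = H.toSubmodule ⊔
      ⨆ (α : H.root) (_ : B.IsPos α), (rootSpace H (α : LieModule.Weight k H L)).toSubmodule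

/-- A parabolic subalgebra: a subalgebra that contains a Borel subalgebra. -/
def IsParabolic (p : LieSubalgebra k L) : Prop :=
  ∃ b : LieSubalgebra k L, IsBorel b ∧ b ≤ p

end

end LieIndex

/-! Fix a Cartan subalgebra `H` of dimension `ℓ`, a base, and a set `Y` of roots closed under
negation and addition that contains the positive summands of its elements. Then `H`, the positive
root spaces and the negative root spaces of `Y` span a parabolic subalgebra `p`. Let `l₁` be the
Kostant cascade of all positive roots and `l₂` that of the negative roots of `Y`. Let `f` be a
combination, with nonzero coefficients `a`, of the coordinates dual to the root vectors of `l₁ ∪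
l₂`, and let `C` be the set of members of `l₂` whose negatives lie in `l₁`.

For suitable `a`, the radical of `Φ_f` on `p` has at most the dimension of the iterated radical of
the single coordinate forms (`exists_finrank_radical_sum_le`). Maximality of heights in the cascades
makes that iterated radical computable (`foldl_radical`): it is the common kernel in `H` of `l₁ ∪
l₂`, plus the root lines of `C`, as long as Cartan elements separate the members of `l₂` outside
`C`. Explicit kernel vectors attain the bound (`radical_eq_map_twist`). The kernel `K` so found is
commutative, and the Killing form shows that it meets the span of `⁅K, L⁆` trivially
(`disjoint_span_lie_twist`). A linear form with this property realizes the index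
(`index_eq_finrank_ker`), so `χ(p) = ℓ - dim span (l₁ ∪ l₂) + |C|` (`index_eq_of_cascades`).

Two families of `Y` give all values. If `i ≥ ℓ - |l₁|`, let `Y` be the set of roots left after `ℓ -
i` steps of the cascade `l₁`. Then `l₂` is the negated tail of `l₁`, all of it lies in `C`, and the
index is `i`. If `i < ℓ - |l₁|`, let `Y = ±T` with `T` a set of pairwise orthogonal simple roots,
independent of `l₁`. Then `C` is empty and the index is `ℓ - |l₁| - |T|`. Large enough `T` exist by
the combinatorial lemma `exists_sparse`, which finds `ℓ - |l₁|` such simple roots. -/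

set_option linter.unusedSectionVars false

/-! ### Derivations applied to determinants. -/

section Determinant

open Finset Matrix

variable {n R : Type*} [DecidableEq n] [CommRing R]

theorem Derivation.map_prod_eq_sum {k : Type*} [CommRing k] [Algebra k R] (D : Derivation k R R)
    (s : Finset n) (f : n → R) :
    D (∏ i ∈ s, f i) = ∑ i ∈ s, D (f i) * ∏ l ∈ s.erase i, f l := by
  induction s using Finset.induction_on with
  | empty => simp
  | insert a s ha ih =>
    rw [prod_insert ha, Derivation.leibniz, ih, sum_insert ha, erase_insert ha, add_comm,
      smul_eq_mul, smul_eq_mul, mul_comm, Finset.mul_sum]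
    congr 1
    refine sum_congr rfl fun i hi => ?_
    rw [erase_insert_of_ne (by rintro rfl; exact ha hi),
      prod_insert (fun h => ha (mem_of_mem_erase h))]
    ring

variable [Fintype n]

theorem Matrix.sum_det_updateCol (M P : Matrix n n R) :
    ∑ j, (M.updateCol j (fun i => P i j)).det =
      ∑ σ : Equiv.Perm n, Equiv.Perm.sign σ •
        ∑ j, P (σ j) j * ∏ l ∈ univ.erase j, M (σ l) l := by
  simp only [det_apply, Finset.smul_sum]
  rw [Finset.sum_comm]
  refine sum_congr rfl fun σ _ => sum_congr rfl fun j _ => ?_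
  congr 1
  rw [← mul_prod_erase univ _ (mem_univ j), updateCol_self]
  congr 1
  exact prod_congr rfl fun l hl => updateCol_ne (ne_of_mem_erase hl)

/-- Expanded over permutations, both sides are the sum of all terms in which one factor from `M` is
replaced by the corresponding factor from `P`. -/
theorem Matrix.sum_det_updateRow (M P : Matrix n n R) :
    ∑ i, (M.updateRow i (P i)).det = ∑ j, (M.updateCol j (fun i => P i j)).det := by
  rw [sum_det_updateCol]
  simp only [det_apply]
  rw [Finset.sum_comm]
  refine sum_congr rfl fun σ _ => ?_
  rw [← Finset.smul_sum]
  congr 1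
  rw [← Equiv.sum_comp σ]
  refine sum_congr rfl fun j _ => ?_
  rw [← mul_prod_erase univ _ (mem_univ j), updateRow_self]
  congr 1
  exact prod_congr rfl fun l hl => by
    rw [updateRow_ne (σ.injective.ne (ne_of_mem_erase hl))]

theorem Derivation.map_det {k : Type*} [CommRing k] [Algebra k R] (D : Derivation k R R)
    (M : Matrix n n R) :
    D M.det = ∑ j, (M.updateCol j (fun i => D (M i j))).det := by
  rw [sum_det_updateCol M (fun i j => D (M i j)), det_apply, map_sum]
  refine sum_congr rfl fun σ _ => ?_
  rw [← D.map_prod_eq_sum univ (fun l => M (σ l) l)]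
  rcases Int.units_eq_one_or (Equiv.Perm.sign σ) with h | h <;> simp [h]

end Determinant

namespace LieIndex

open Module LieAlgebra MvPolynomial

/-! ### Coadjoint vector fields and minors of the generic coadjoint form. -/

section GenericForm

variable {k A ι : Type*} [Field k] [LieRing A] [LieAlgebra k A] [Fintype ι]

theorem coadjointForm_apply (f : Dual k A) (x y : A) : coadjointForm f x y = f ⁅x, y⁆ := rfl

theorem mem_ker_coadjointForm {f : Dual k A} {x : A} :
    x ∈ LinearMap.ker (coadjointForm f) ↔ ∀ y, f ⁅x, y⁆ = 0 := by
  rw [LinearMap.mem_ker, LinearMap.ext_iff]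
  rfl

/-- The generic translate `f + ∑ Xᵢ bᵢ*` of a linear form `f`, with polynomial values. -/
noncomputable def genericForm (f : Dual k A) (b : Basis ι k A) : A →ₗ[k] MvPolynomial ι k :=
  (Algebra.linearMap k (MvPolynomial ι k)).comp f +
    ∑ i, (LinearMap.toSpanSingleton k (MvPolynomial ι k) (X i)).comp (b.coord i)

theorem genericForm_apply (f : Dual k A) (b : Basis ι k A) (v : A) :
    genericForm f b v = C (f v) + ∑ i, b.repr v i • X i := by
  simp [genericForm, MvPolynomial.algebraMap_eq]

theorem eval_genericForm (f : Dual k A) (b : Basis ι k A) (a : ι → k) (v : A) :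
    eval a (genericForm f b v) = f v + ∑ i, b.repr v i * a i := by
  simp [genericForm_apply, smul_eval]

/-- The derivation of the polynomial ring induced by the coadjoint action of `x`. -/
noncomputable def coadjointDerivation (f : Dual k A) (b : Basis ι k A) (x : A) :
    Derivation k (MvPolynomial ι k) (MvPolynomial ι k) :=
  mkDerivation k fun i => -genericForm f b ⁅x, b i⁆

/-- The constant `f v` is killed, so translating by `f` only recentres the coordinates: the
derivation is the coadjoint vector field of `x` seen from `f`. -/
theorem coadjointDerivation_genericForm (f : Dual k A) (b : Basis ι k A) (x v : A) :
    coadjointDerivation f b x (genericForm f b v) = -genericForm f b ⁅x, v⁆ := by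
  conv_rhs => rw [← b.sum_repr v]
  simp only [genericForm_apply f b v, coadjointDerivation, map_add, derivation_C, map_sum,
    Derivation.map_smul, mkDerivation_X, zero_add, smul_neg, lie_sum, lie_smul, map_smul,
    Finset.sum_neg_distrib]

/-- The minor of the generic coadjoint form on two families of vectors. -/
noncomputable def genericMinor (f : Dual k A) (b : Basis ι k A) {m : ℕ} (u v : Fin m → A) :
    MvPolynomial ι k :=
  (Matrix.of fun i j => genericForm f b ⁅u i, v j⁆).det

/-- By the Jacobi identity the derivative of each entry splits into a row part and a column part.
Hence the span of the minors of size `m` is stable under all coadjoint vector fields, which drives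
the induction in `genericMinor_eq_zero`. -/
theorem coadjointDerivation_genericMinor (f : Dual k A) (b : Basis ι k A) {m : ℕ}
    (u v : Fin m → A) (x : A) :
    coadjointDerivation f b x (genericMinor f b u v) =
      -∑ i, genericMinor f b (Function.update u i ⁅x, u i⁆) v -
        ∑ j, genericMinor f b u (Function.update v j ⁅x, v j⁆) := by
  set M : Matrix (Fin m) (Fin m) (MvPolynomial ι k) :=
    Matrix.of fun i j => genericForm f b ⁅u i, v j⁆ with hM
  have hcol : ∀ j, M.updateCol j (fun i => genericForm f b ⁅u i, ⁅x, v j⁆⁆) =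
      Matrix.of fun i l => genericForm f b ⁅u i, Function.update v j ⁅x, v j⁆ l⁆ := by
    intro j
    ext1 i l
    rcases eq_or_ne l j with rfl | h
    · simp
    · simp [h, hM]
  have hrow : ∀ i, M.updateRow i (fun j => genericForm f b ⁅⁅x, u i⁆, v j⁆) =
      Matrix.of fun r l => genericForm f b ⁅Function.update u i ⁅x, u i⁆ r, v l⁆ := by
    intro i
    ext1 r l
    rcases eq_or_ne r i with rfl | h
    · simp
    · simp [h, hM]
  have key : ∀ j, (M.updateCol j fun i => coadjointDerivation f b x (M i j)).det =
      -(M.updateCol j fun i => genericForm f b ⁅⁅x, u i⁆, v j⁆).det -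
        (M.updateCol j fun i => genericForm f b ⁅u i, ⁅x, v j⁆⁆).det := by
    intro j
    have : (fun i => coadjointDerivation f b x (M i j)) =
        (-1 : MvPolynomial ι k) • (fun i => genericForm f b ⁅⁅x, u i⁆, v j⁆) +
          (-1 : MvPolynomial ι k) • (fun i => genericForm f b ⁅u i, ⁅x, v j⁆⁆) := by
      ext1 i
      simp only [hM, Matrix.of_apply, coadjointDerivation_genericForm, Pi.add_apply, Pi.smul_apply,
        smul_eq_mul, leibniz_lie x (u i), map_add]
      ring
    rw [this, Matrix.det_updateCol_add, Matrix.det_updateCol_smul, Matrix.det_updateCol_smul]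
    ring
  rw [genericMinor, Derivation.map_det]
  rw [Finset.sum_congr rfl fun j _ => key j, Finset.sum_sub_distrib, Finset.sum_neg_distrib,
    ← Matrix.sum_det_updateRow M (fun i j => genericForm f b ⁅⁅x, u i⁆, v j⁆)]
  simp only [hrow, hcol, genericMinor]

theorem coadjointDerivation_eq_sum (f : Dual k A) (b : Basis ι k A) (x : A)
    (p : MvPolynomial ι k) :
    coadjointDerivation f b x p = ∑ i, -genericForm f b ⁅x, b i⁆ * pderiv i p := by
  classical
  have : coadjointDerivation f b x =
      ∑ i, (-genericForm f b ⁅x, b i⁆) • (pderiv i : Derivation k (MvPolynomial ι k) _) := by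
    refine derivation_ext fun j => ?_
    rw [coadjointDerivation, mkDerivation_X, ← Derivation.coeFnAddMonoidHom_apply, map_sum,
      Finset.sum_apply, Finset.sum_eq_single j]
    · simp
    · intro i _ h
      simp [pderiv_X_of_ne h.symm]
    · simp
  rw [this, ← Derivation.coeFnAddMonoidHom_apply, map_sum, Finset.sum_apply]
  simp

end GenericForm

end LieIndex

namespace LieIndex

open Module LieAlgebra MvPolynomial

/-! ### Linear forms whose stabilizer has the least dimension. -/

section StableForm

variable {k A : Type*} [Field k] [LieRing A] [LieAlgebra k A]

theorem coadjointForm_isAlt (f : Dual k A) : (coadjointForm f).IsAlt := fun x => by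
  simp [coadjointForm_apply]

theorem add_finrank_ker_le_of_det_ne_zero [FiniteDimensional k A] (f : Dual k A) {m : ℕ}
    (u v : Fin m → A) (K : Submodule k A) (hK : ∀ x ∈ K, ∀ y, f ⁅x, y⁆ = 0)
    (h : (Matrix.of fun i j => f ⁅u i, v j⁆).det ≠ 0) :
    m + finrank k K ≤ finrank k A := by
  have hu : ∀ a : Fin m → k, ∑ i, a i • u i ∈ K → a = 0 := by
    intro a ha
    by_contra hne
    refine h (Matrix.exists_vecMul_eq_zero_iff.mp ⟨a, hne, ?_⟩)
    ext j
    have := hK _ ha (v j)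
    simpa [Matrix.vecMul, dotProduct, sum_lie] using this
  have hli : LinearIndependent k u := by
    rw [Fintype.linearIndependent_iff]
    intro a ha
    exact congrFun (hu a (by rw [ha]; exact K.zero_mem))
  have hdisj : Disjoint (Submodule.span k (Set.range u)) K := by
    rw [Submodule.disjoint_def]
    intro x hx hxK
    obtain ⟨a, rfl⟩ := (Submodule.mem_span_range_iff_exists_fun k).mp hx
    simp [hu a hxK]
  have := Submodule.finrank_add_finrank_le_of_disjoint hdisj
  rwa [finrank_span_eq_card hli, Fintype.card_fin] at this

/-- The `ι₁` vectors span the stabilizer `K` of `f`; the `ι₂` directions of the dual are tangent to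
the coadjoint orbit of `f`, and the `ι₁` directions form a slice transverse to it. On the slice `K`
still stabilizes, which bounds the rank by `|ι₂|`. Coadjoint vector fields carry the vanishing of
the minors off the slice, one degree of Taylor coefficients at a time. -/
theorem genericMinor_eq_zero [Infinite k] [CharZero k] [FiniteDimensional k A] {ι₁ ι₂ : Type*}
    [Fintype ι₁] [Fintype ι₂] (f : Dual k A) (b : Basis (ι₁ ⊕ ι₂) k A)
    (hker : ∀ i (x : A), f ⁅b (.inl i), x⁆ = 0)
    (hlie : ∀ i j (x : A), b.repr ⁅b (.inl i), x⁆ (.inl j) = 0)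
    (hdual : ∀ r, ∃ x : A, ∀ y : A, f ⁅x, y⁆ = b.repr y (.inr r))
    {m : ℕ} (hm : Fintype.card ι₂ < m) (u v : Fin m → A) : genericMinor f b u v = 0 := by
  classical
  suffices H : ∀ N, ∀ (u v : Fin m → A) (μ : ι₁ ⊕ ι₂ →₀ ℕ), μ.degree = N →
      (genericMinor f b u v).coeff μ = 0 by
    ext μ
    simpa using H _ u v μ rfl
  intro N
  induction N using Nat.strong_induction_on with
  | _ N ih =>
  intro u v μ hμ
  by_cases hr : ∃ r, μ (.inr r) ≠ 0
  · obtain ⟨r, hr⟩ := hr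
    obtain ⟨x, hx⟩ := hdual r
    obtain ⟨ν, rfl⟩ : ∃ ν, μ = ν + Finsupp.single (.inr r) 1 := by
      refine ⟨μ - Finsupp.single (.inr r) 1, (tsub_add_cancel_of_le ?_).symm⟩
      rw [Finsupp.single_le_iff]
      omega
    rw [map_add, Finsupp.degree_single] at hμ
    have h1 : (coadjointDerivation f b x (genericMinor f b u v)).coeff ν = 0 := by
      rw [coadjointDerivation_genericMinor]
      have h0 : ∀ u v : Fin m → A, (genericMinor f b u v).coeff ν = 0 :=
        fun u v => ih ν.degree (by omega) u v ν rfl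
      simp [coeff_sum, h0]
    have h2 : ∀ i j, (X j * pderiv i (genericMinor f b u v)).coeff ν = 0 := by
      intro i j
      rw [coeff_X_mul']
      split_ifs with hj
      · rw [coeff_pderiv]
        have hj' : Finsupp.single j 1 ≤ ν := by
          rw [Finsupp.single_le_iff]
          exact Nat.one_le_iff_ne_zero.mpr (Finsupp.mem_support_iff.mp hj)
        have hd : (ν - Finsupp.single j 1).degree + 1 = ν.degree := by
          conv_rhs => rw [← tsub_add_cancel_of_le hj', map_add, Finsupp.degree_single]
        rw [ih ν.degree (by omega) u v _ (by rw [map_add, Finsupp.degree_single, hd]), zero_mul]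
      · rfl
    -- By the choice of `x`, the constant part of the vector field is minus the derivative in the
    -- `r`-th direction. Its linear part only reaches coefficients of the degree of `ν`, which
    -- vanish by induction.
    have h3 : ∀ i, (-genericForm f b ⁅x, b i⁆ * pderiv i (genericMinor f b u v)).coeff ν =
        -(b.repr (b i) (.inr r) * (pderiv i (genericMinor f b u v)).coeff ν) := by
      intro i
      rw [genericForm_apply, hx, neg_mul, add_mul, Finset.sum_mul, coeff_neg, coeff_add, coeff_C_mul,
        coeff_sum, Finset.sum_eq_zero, add_zero]
      intro j _
      rw [smul_mul_assoc, coeff_smul, h2, smul_zero]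
    rw [coadjointDerivation_eq_sum, coeff_sum, Finset.sum_congr rfl fun i _ => h3 i,
      Finset.sum_eq_single (.inr r), Basis.repr_self, Finsupp.single_eq_same, one_mul, neg_eq_zero,
      coeff_pderiv, mul_eq_zero] at h1
    · exact h1.resolve_right (Nat.cast_add_one_ne_zero _)
    · intro i _ hi
      rw [Basis.repr_self, Finsupp.single_eq_of_ne hi.symm, zero_mul, neg_zero]
    · simp
  · push Not at hr
    have hinj : Function.Injective (Sum.inl : ι₁ → ι₁ ⊕ ι₂) := Sum.inl_injective
    obtain ⟨ν, rfl⟩ : ∃ ν : ι₁ →₀ ℕ, μ = ν.mapDomain Sum.inl := by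
      refine ⟨μ.comapDomain Sum.inl hinj.injOn, (Finsupp.mapDomain_comapDomain _ hinj _ ?_).symm⟩
      rintro (i | i) hi
      · exact ⟨i, rfl⟩
      · simp [hr] at hi
    rw [← coeff_killCompl hinj]
    suffices killCompl hinj (genericMinor f b u v) = 0 by rw [this, coeff_zero]
    refine MvPolynomial.funext fun a => ?_
    -- A monomial in the `ι₁` variables alone is seen on the slice, where the `ι₂` variables are
    -- zero.
    set a' : ι₁ ⊕ ι₂ → k := Sum.elim a 0
    have heval : ∀ p : MvPolynomial (ι₁ ⊕ ι₂) k, eval a (killCompl hinj p) = eval a' p := by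
      intro p
      have : ((aeval a).comp (killCompl hinj) : MvPolynomial (ι₁ ⊕ ι₂) k →ₐ[k] k) = aeval a' := by
        refine algHom_ext fun i => ?_
        rcases i with i | i
        · rw [AlgHom.comp_apply, ← rename_X Sum.inl, killCompl_rename_app]
          simp [a']
        · simp [killCompl, a']
      simpa [aeval_eq_eval] using congrArg (fun φ => φ p) this
    rw [heval, map_zero, genericMinor, RingHom.map_det]
    by_contra hne
    set g : Dual k A := f + ∑ i, a' i • b.coord i
    have hg : ∀ y, g y = eval a' (genericForm f b y) := by
      intro y
      simp [g, eval_genericForm, mul_comm]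
    set K := Submodule.span k (Set.range fun i => b (.inl i))
    have hK : ∀ x ∈ K, ∀ y, g ⁅x, y⁆ = 0 := by
      intro x hx y
      induction hx using Submodule.span_induction with
      | mem x hx =>
        obtain ⟨i, rfl⟩ := hx
        simp [hg, eval_genericForm, hker, hlie, a']
      | zero => simp
      | add x z _ _ hx hz => rw [add_lie, map_add, hx, hz, add_zero]
      | smul c x _ hx => rw [smul_lie, map_smul, hx, smul_zero]
    have hmat : (eval a').mapMatrix (Matrix.of fun i j => genericForm f b ⁅u i, v j⁆) =
        Matrix.of fun i j => g ⁅u i, v j⁆ := by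
      ext1 i j
      simp [hg]
    rw [hmat] at hne
    have hle := add_finrank_ker_le_of_det_ne_zero g u v K hK hne
    have hKd : finrank k K = Fintype.card ι₁ :=
      finrank_span_eq_card (b.linearIndependent.comp _ hinj)
    rw [hKd, finrank_eq_card_basis b, Fintype.card_sum] at hle
    omega

/-- If the stabilizer of a linear form meets its bracket with the whole Lie algebra trivially,
then it has the least possible dimension. -/
theorem finrank_ker_coadjointForm_le [CharZero k] [FiniteDimensional k A] (f g : Dual k A)
    (hf : Disjoint (LinearMap.ker (coadjointForm f))
      (Submodule.span k {z | ∃ x ∈ LinearMap.ker (coadjointForm f), ∃ y, ⁅x, y⁆ = z})) :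
    finrank k (LinearMap.ker (coadjointForm f)) ≤ finrank k (LinearMap.ker (coadjointForm g)) := by
  set K := LinearMap.ker (coadjointForm f)
  -- The complement of `K` is chosen to contain `⁅K, A⁆`; this is the only use of `hf`.
  obtain ⟨q, hle, hKq⟩ := hf.symm.exists_isCompl
  let b₁ := finBasis k K
  let b₂ := finBasis k q
  let b : Basis _ k A := (b₁.prod b₂).map (Submodule.prodEquivOfIsCompl K q hKq.symm)
  have hb₁ : ∀ i, b (.inl i) = b₁ i := fun i => by simp [b]
  have hrepr₁ : ∀ y ∈ q, ∀ i, b.repr y (.inl i) = 0 := by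
    intro y hy i
    simp [b, Submodule.prodEquivOfIsCompl_symm_apply_right K q hKq.symm ⟨y, hy⟩]
  have hrepr₂ : ∀ y ∈ K, ∀ i, b.repr y (.inr i) = 0 := by
    intro y hy i
    simp [b, Submodule.prodEquivOfIsCompl_symm_apply_left K q hKq.symm ⟨y, hy⟩]
  by_contra! hlt
  obtain ⟨C, hC⟩ := (LinearMap.ker (coadjointForm g)).exists_isCompl
  have hdC := Submodule.finrank_add_eq_of_isCompl hC
  have hdK := Submodule.finrank_add_eq_of_isCompl hKq
  let c := finBasis k C
  have hzero := genericMinor_eq_zero f b (fun i x => ?_) (fun i j x => ?_) (fun r => ?_)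
    (m := finrank k C) (by rw [Fintype.card_fin]; omega) (fun i => (c i : A)) (fun i => (c i : A))
  -- At this point the generic form specializes to `g`, whose form is nondegenerate on the
  -- complement `C` of its kernel. The vanishing minor, of size `finrank k C`, contradicts this.
  · have hev := congrArg (eval fun i => (g - f) (b i)) hzero
    have hgen : ∀ y, eval (fun i => (g - f) (b i)) (genericForm f b y) = g y := by
      intro y
      have : (g - f) y = ∑ i, b.repr y i * (g - f) (b i) := by
        conv_lhs => rw [← b.sum_repr y, map_sum]
        simp only [map_smul, smul_eq_mul]
      rw [eval_genericForm, ← this]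
      simp
    rw [genericMinor, RingHom.map_det, map_zero] at hev
    obtain ⟨a, ha, hMa⟩ := Matrix.exists_mulVec_eq_zero_iff.mpr hev
    set x : C := ∑ j, a j • c j with hx
    have h1 : ∀ i, g ⁅(c i : A), (x : A)⁆ = 0 := by
      intro i
      have := congrFun hMa i
      simp only [Matrix.mulVec, dotProduct, RingHom.mapMatrix_apply, Matrix.map_apply,
        Matrix.of_apply, hgen, Pi.zero_apply] at this
      simpa [hx, lie_sum, mul_comm] using this
    have h2 : ∀ y ∈ C, g ⁅y, (x : A)⁆ = 0 := by
      intro y hy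
      have hy' : ((∑ i, c.repr ⟨y, hy⟩ i • c i : C) : A) = y := by rw [c.sum_repr]
      rw [← hy', Submodule.coe_sum, sum_lie, map_sum]
      exact Finset.sum_eq_zero fun i _ => by rw [Submodule.coe_smul, smul_lie, map_smul, h1, smul_zero]
    have h3 : (x : A) ∈ LinearMap.ker (coadjointForm g) := by
      rw [mem_ker_coadjointForm]
      intro y
      obtain ⟨y₁, hy₁, y₂, hy₂, rfl⟩ := Submodule.mem_sup.mp (hC.sup_eq_top ▸ Submodule.mem_top (x := y))
      rw [← lie_skew, map_neg, add_lie, map_add, h2 _ hy₂, mem_ker_coadjointForm.mp hy₁]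
      simp
    have hx0 : x = 0 := by
      have := (Submodule.disjoint_def.mp hC.disjoint) _ h3 x.2
      exact_mod_cast this
    exact ha (funext fun i => by
      have := Fintype.linearIndependent_iff.mp c.linearIndependent a (by rw [← hx, hx0]) i
      simpa using this)
  · rw [hb₁]
    exact mem_ker_coadjointForm.mp (b₁ i).2 x
  · rw [hb₁]
    exact hrepr₁ _ (hle (Submodule.subset_span ⟨_, (b₁ i).2, x, rfl⟩)) j
  · have hmem : b.coord (.inr r) ∈ (LinearMap.ker (coadjointForm f)).dualAnnihilator := by
      rw [Submodule.mem_dualAnnihilator]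
      exact fun y hy => hrepr₂ y hy r
    rw [LinearMap.dualAnnihilator_ker_eq_range_flip] at hmem
    obtain ⟨x, hx⟩ := hmem
    refine ⟨-x, fun y => ?_⟩
    have := LinearMap.congr_fun hx y
    rw [LinearMap.flip_apply, coadjointForm_apply] at this
    rw [neg_lie, lie_skew, this]
    rfl

theorem index_eq_finrank_ker [CharZero k] [FiniteDimensional k A] (f : Dual k A)
    (hf : Disjoint (LinearMap.ker (coadjointForm f))
      (Submodule.span k {z | ∃ x ∈ LinearMap.ker (coadjointForm f), ∃ y, ⁅x, y⁆ = z})) :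
    index k A = finrank k (LinearMap.ker (coadjointForm f)) :=
  le_antisymm (ciInf_le (OrderBot.bddBelow _) f)
    (le_ciInf fun g => finrank_ker_coadjointForm_le f g hf)

end StableForm

end LieIndex

namespace LieIndex

open Module

/-! ### Radicals of linear combinations of alternating forms. -/

section Radical

variable {k V : Type*} [Field k] [AddCommGroup V] [Module k V]

/-- The radical of the restriction of a bilinear form to a subspace. -/
def radical (Φ : LinearMap.BilinForm k V) (W : Submodule k V) : Submodule k V where
  carrier := {x | x ∈ W ∧ ∀ y ∈ W, Φ x y = 0}
  add_mem' := fun hx hy => ⟨W.add_mem hx.1 hy.1, fun z hz => by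
    rw [map_add, LinearMap.add_apply, hx.2 z hz, hy.2 z hz, add_zero]⟩
  zero_mem' := ⟨W.zero_mem, fun z _ => by simp⟩
  smul_mem' := fun c x hx => ⟨W.smul_mem c hx.1, fun z hz => by
    rw [map_smul, LinearMap.smul_apply, hx.2 z hz, smul_zero]⟩

theorem radical_le (Φ : LinearMap.BilinForm k V) (W : Submodule k V) : radical Φ W ≤ W :=
  fun _ hx => hx.1

theorem exists_disjoint_sup_eq {K U : Submodule k V} (h : K ≤ U) :
    ∃ T ≤ U, Disjoint K T ∧ K ⊔ T = U := by
  obtain ⟨K', hK'⟩ := K.exists_isCompl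
  refine ⟨K' ⊓ U, inf_le_right, hK'.disjoint.mono_right inf_le_left, ?_⟩
  rw [← sup_inf_assoc_of_le _ h, hK'.sup_eq_top, top_inf_eq]

theorem det_ne_zero_of_compl_radical {n : Type*} [Fintype n] [DecidableEq n]
    {Φ : LinearMap.BilinForm k V} (hΦ : Φ.IsAlt) {U T : Submodule k V} (hT : T ≤ U)
    (hd : Disjoint (radical Φ U) T) (hs : radical Φ U ⊔ T = U) (t : Basis n k T) :
    (Matrix.of fun i j => Φ (t i) (t j)).det ≠ 0 := by
  intro h
  obtain ⟨a, ha, hMa⟩ := Matrix.exists_mulVec_eq_zero_iff.mpr h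
  set x : T := ∑ j, a j • t j with hx
  have h1 : ∀ i, Φ (t i) x = 0 := by
    intro i
    have := congrFun hMa i
    simpa [Matrix.mulVec, dotProduct, hx, mul_comm] using this
  have h2 : ∀ y : T, Φ y x = 0 := by
    intro y
    rw [← t.sum_repr y, Submodule.coe_sum, map_sum, LinearMap.sum_apply]
    exact Finset.sum_eq_zero fun i _ => by simp [h1]
  have h3 : (x : V) ∈ radical Φ U := by
    refine ⟨hT x.2, fun y hy => ?_⟩
    obtain ⟨y₁, hy₁, y₂, hy₂, rfl⟩ := Submodule.mem_sup.mp (hs ▸ hy)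
    rw [map_add, ← hΦ.neg_eq, ← hΦ.neg_eq y₂, hy₁.2 _ (hT x.2), h2 ⟨y₂, hy₂⟩]
    simp
  have hx0 : x = 0 := by
    have := Submodule.disjoint_def.mp hd _ h3 x.2
    exact_mod_cast this
  exact ha (funext (Fintype.linearIndependent_iff.mp t.linearIndependent a (by rw [← hx, hx0])))

variable [Infinite k] [FiniteDimensional k V]

theorem exists_ne_zero_eval_ne_zero {p : Polynomial k} (h : p.eval 0 ≠ 0) :
    ∃ s, s ≠ 0 ∧ p.eval s ≠ 0 := by
  have hp : p ≠ 0 := by rintro rfl; simp at h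
  by_contra! hs
  refine mul_ne_zero hp Polynomial.X_ne_zero (Polynomial.funext fun s => ?_)
  by_cases h0 : s = 0 <;> simp [h0, hs s]

/-- Let `T` complement the inner radical in `U`, and `C` complement `U` in `W`. With the basis of
`C` multiplied by `s`, the Gram matrix of `s⁻² • Φ₁ + Φ₂` on `T ⊔ C` is polynomial in `s`, and at `s
= 0` it is block diagonal with invertible blocks. Some nonzero `s` keeps it invertible, so the
radical misses `T ⊔ C`, whose codimension in `W` is the right-hand side. -/
theorem exists_finrank_radical_smul_add_le {Φ₁ Φ₂ : LinearMap.BilinForm k V} (h₁ : Φ₁.IsAlt)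
    (h₂ : Φ₂.IsAlt) (W : Submodule k V) :
    ∃ a : k, a ≠ 0 ∧
      finrank k (radical (a • Φ₁ + Φ₂) W) ≤ finrank k (radical Φ₂ (radical Φ₁ W)) := by
  set U := radical Φ₁ W with hU
  obtain ⟨T, hTU, hTd, hTs⟩ := exists_disjoint_sup_eq (radical_le Φ₂ U)
  obtain ⟨C, hCW, hCd, hCs⟩ := exists_disjoint_sup_eq (radical_le Φ₁ W)
  let t := finBasis k T
  let c := finBasis k C
  have hdt := det_ne_zero_of_compl_radical h₂ hTU hTd hTs t
  have hdc := det_ne_zero_of_compl_radical h₁ hCW hCd hCs c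
  let M : Matrix _ _ (Polynomial k) := Matrix.fromBlocks
    (Matrix.of fun i j => Polynomial.C (Φ₂ (t i) (t j)))
    (Matrix.of fun i j => Polynomial.X * Polynomial.C (Φ₂ (t i) (c j)))
    (Matrix.of fun i j => Polynomial.X * Polynomial.C (Φ₂ (c i) (t j)))
    (Matrix.of fun i j => Polynomial.C (Φ₁ (c i) (c j)) +
      Polynomial.X ^ 2 * Polynomial.C (Φ₂ (c i) (c j)))
  have hM : ∀ s, (Polynomial.evalRingHom s).mapMatrix M = Matrix.fromBlocks
      (Matrix.of fun i j => Φ₂ (t i) (t j))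
      (Matrix.of fun i j => s * Φ₂ (t i) (c j))
      (Matrix.of fun i j => s * Φ₂ (c i) (t j))
      (Matrix.of fun i j => Φ₁ (c i) (c j) + s ^ 2 * Φ₂ (c i) (c j)) := by
    intro s
    ext1 (i | i) (j | j) <;> simp [M] <;> ring
  have hM0 : M.det.eval 0 ≠ 0 := by
    rw [← Polynomial.coe_evalRingHom, RingHom.map_det, hM]
    have hz : ∀ (m n : Type) , (Matrix.of fun (_ : m) (_ : n) => (0 : k)) = 0 := fun _ _ => rfl
    simp only [zero_mul, ne_eq, OfNat.ofNat_ne_zero, not_false_eq_true, zero_pow, add_zero, hz,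
      Matrix.det_fromBlocks_zero₂₁]
    exact mul_ne_zero hdt hdc
  obtain ⟨s, hs0, hs⟩ := exists_ne_zero_eval_ne_zero hM0
  rw [← Polynomial.coe_evalRingHom, RingHom.map_det, hM] at hs
  refine ⟨(s ^ 2)⁻¹, inv_ne_zero (pow_ne_zero 2 hs0), ?_⟩
  set Ψ := (s ^ 2)⁻¹ • Φ₁ + Φ₂ with hΨ
  have hΨalt : Ψ.IsAlt := (h₁.smul _).add h₂
  have hdisj : Disjoint (radical Ψ W) (T ⊔ C) := by
    rw [Submodule.disjoint_def]
    intro x hxr hx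
    obtain ⟨x₁, hx₁, x₂, hx₂, rfl⟩ := Submodule.mem_sup.mp hx
    set α := t.repr ⟨x₁, hx₁⟩
    set β := c.repr ⟨x₂, hx₂⟩
    have e₁ : x₁ = ∑ j, α j • (t j : V) := by
      have : ((∑ j, α j • t j : T) : V) = x₁ := by rw [t.sum_repr]
      rw [← this, Submodule.coe_sum]; rfl
    have e₂ : x₂ = ∑ j, β j • (c j : V) := by
      have : ((∑ j, β j • c j : C) : V) = x₂ := by rw [c.sum_repr]
      rw [← this, Submodule.coe_sum]; rfl
    have hW : ∀ y ∈ W, Ψ y (x₁ + x₂) = 0 := fun y hy => by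
      rw [← hΨalt.neg_eq, hxr.2 y hy, neg_zero]
    -- The factor `s⁻¹` expresses `x₂` in the rescaled basis of `C`.
    have hv : Sum.elim (fun j => α j) (fun j => s⁻¹ * β j) = 0 := by
      by_contra hne
      refine hs (Matrix.exists_mulVec_eq_zero_iff.mp ⟨_, hne, ?_⟩)
      rw [Matrix.fromBlocks_mulVec]
      ext (i | i)
      · have hi := hW (t i) (radical_le _ _ (hTU (t i).2))
        have hi' : Φ₁ (t i) (x₁ + x₂) = 0 :=
          (hTU (t i).2).2 _ (W.add_mem (radical_le _ _ (hTU hx₁)) (hCW hx₂))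
        rw [hΨ, LinearMap.add_apply, LinearMap.add_apply, LinearMap.smul_apply,
          LinearMap.smul_apply, hi', smul_zero, zero_add, e₁, e₂] at hi
        rw [map_add, map_sum, map_sum] at hi
        simp only [map_smul, smul_eq_mul] at hi
        simp only [Sum.elim_inl, Pi.add_apply, Matrix.mulVec, dotProduct, Matrix.of_apply,
          Function.comp_def, Sum.elim_inr, Pi.zero_apply]
        rw [← hi]
        congr 1 <;> refine Finset.sum_congr rfl fun j _ => ?_
        · ring
        · field_simp
      · have hi := hW (c i) (hCW (c i).2)
        have hi' : Φ₁ (c i) x₁ = 0 := by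
          rw [← h₁.neg_eq, (hTU hx₁).2 _ (hCW (c i).2), neg_zero]
        rw [hΨ, LinearMap.add_apply, LinearMap.add_apply, LinearMap.smul_apply,
          LinearMap.smul_apply, map_add, hi', zero_add, map_add, e₁, e₂] at hi
        simp only [map_sum, map_smul, smul_eq_mul] at hi
        simp only [Sum.elim_inl, Pi.add_apply, Matrix.mulVec, dotProduct, Matrix.of_apply,
          Function.comp_def, Sum.elim_inr, Pi.zero_apply]
        have : s * ((s ^ 2)⁻¹ * ∑ j, β j * Φ₁ (c i) (c j) +
            (∑ j, α j * Φ₂ (c i) (t j) + ∑ j, β j * Φ₂ (c i) (c j))) = 0 := by rw [hi, mul_zero]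
        rw [← this, mul_add, mul_add, Finset.mul_sum, Finset.mul_sum, Finset.mul_sum,
          Finset.mul_sum, add_left_comm, ← Finset.sum_add_distrib]
        congr 1 <;> refine Finset.sum_congr rfl fun j _ => ?_
        · ring
        · field_simp
    have hα : ∀ j, α j = 0 := fun j => congrFun hv (.inl j)
    have hβ : ∀ j, β j = 0 := fun j => by
      have := congrFun hv (.inr j)
      simpa [hs0] using this
    rw [e₁, e₂]
    simp [hα, hβ]
  have hTC : Disjoint T C := (hCd.mono_left hTU)
  have d₁ := Submodule.finrank_sup_add_finrank_inf_eq (radical Φ₂ U) T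
  have d₂ := Submodule.finrank_sup_add_finrank_inf_eq (radical Φ₁ W) C
  have d₃ := Submodule.finrank_sup_add_finrank_inf_eq T C
  have d₄ := Submodule.finrank_sup_add_finrank_inf_eq (radical Ψ W) (T ⊔ C)
  have d₅ := Submodule.finrank_mono (sup_le (radical_le Ψ W)
    (sup_le (hTU.trans (radical_le Φ₁ W)) hCW))
  rw [hTd.eq_bot, hTs, finrank_bot] at d₁
  rw [hCd.eq_bot, hCs, finrank_bot, ← hU] at d₂
  rw [hTC.eq_bot, finrank_bot] at d₃
  rw [hdisj.eq_bot, finrank_bot] at d₄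
  omega

theorem exists_finrank_radical_sum_le {ι : Type*} (Φ : ι → LinearMap.BilinForm k V)
    (hΦ : ∀ i, (Φ i).IsAlt) {l : List ι} (hl : l.Nodup) (W : Submodule k V) :
    ∃ a : ι → k, (∀ i, a i ≠ 0) ∧
      finrank k (radical (l.map fun i => a i • Φ i).sum W) ≤
        finrank k (l.foldl (fun W i => radical (Φ i) W) W : Submodule k V) := by
  classical
  induction l generalizing W with
  | nil => exact ⟨1, fun _ => one_ne_zero, Submodule.finrank_mono (radical_le _ W)⟩
  | cons i l ih =>
    obtain ⟨a, ha, hle⟩ := ih hl.of_cons (radical (Φ i) W)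
    have hsum : ∀ (a : ι → k) (l : List ι), (l.map fun i => a i • Φ i).sum.IsAlt := by
      intro a l
      induction l with
      | nil => exact LinearMap.BilinForm.isAlt_zero
      | cons j l ih => exact ((hΦ j).smul _).add ih
    obtain ⟨c, hc, hle'⟩ := exists_finrank_radical_smul_add_le (hΦ i) (hsum a l) W
    refine ⟨Function.update a i c, fun j => ?_, ?_⟩
    · rcases eq_or_ne j i with rfl | h
      · simpa
      · simpa [h] using ha j
    · have : (l.map fun j => Function.update a i c j • Φ j) = l.map fun j => a j • Φ j :=
        List.map_congr_left fun j hj => by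
          rw [Function.update_of_ne (by rintro rfl; exact (List.nodup_cons.mp hl).1 hj)]
      rw [List.map_cons, List.sum_cons, this, Function.update_self]
      exact hle'.trans hle

end Radical

end LieIndex

/-! ### Closed subsystems, faces and Kostant cascades. -/

namespace RootPairing

open Function Set

variable {ι k M N : Type*} [Field k] [CharZero k] [AddCommGroup M] [Module k M]
  [AddCommGroup N] [Module k N] (P : RootPairing ι k M N)

theorem exists_root_eq_neg (i : ι) : ∃ j, P.root j = -P.root i :=
  ⟨P.reflectionPerm i i, by rw [root_reflectionPerm, reflection_apply_self]⟩

/-- An additive integral height function on the roots, without zeros. -/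
structure IsHeight (ht : ι → ℤ) : Prop where
  add : ∀ {i j l}, P.root l = P.root i + P.root j → ht l = ht i + ht j
  neg : ∀ {i j}, P.root j = -P.root i → ht j = -ht i
  ne_zero : ∀ i, ht i ≠ 0

/-- A set of roots closed under negation and addition. -/
structure IsClosedSubsystem (Y : Set ι) : Prop where
  add : ∀ {i j l}, i ∈ Y → j ∈ Y → P.root l = P.root i + P.root j → l ∈ Y
  neg : ∀ {i j}, i ∈ Y → P.root j = -P.root i → j ∈ Y

/-- A set of roots containing the positive summands of each of its elements. -/
def IsFace (ht : ι → ℤ) (Y : Set ι) : Prop :=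
  ∀ ⦃i j l⦄, 0 < ht i → 0 < ht j → P.root l = P.root i + P.root j → l ∈ Y → i ∈ Y

variable {P} {ht : ι → ℤ} {Y : Set ι} {γ : ι}

theorem IsHeight.sub (h : P.IsHeight ht) {i j l : ι} (hl : P.root l = P.root i - P.root j) :
    ht l = ht i - ht j := by
  have := h.add (show P.root i = P.root l + P.root j by rw [hl, sub_add_cancel])
  omega

theorem IsHeight.neg_height (h : P.IsHeight ht) : P.IsHeight (-ht) where
  add hl := by have := h.add hl; simp only [Pi.neg_apply]; omega
  neg hl := by have := h.neg hl; simp only [Pi.neg_apply]; omega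
  ne_zero i := neg_ne_zero.mpr (h.ne_zero i)

theorem Base.isHeight (b : P.Base) : P.IsHeight b.height where
  add := b.height_add
  neg {i j} h := by
    let := P.indexNeg
    rw [← b.height_reflectionPerm_self]
    congr 1
    exact P.root.injective (by rw [h]; simp)
  ne_zero := b.height_ne_zero

theorem IsClosedSubsystem.sub (h : P.IsClosedSubsystem Y) {i j l : ι} (hi : i ∈ Y) (hj : j ∈ Y)
    (hl : P.root l = P.root i - P.root j) : l ∈ Y := by
  obtain ⟨j', hj'⟩ := P.exists_root_eq_neg j
  exact h.add hi (h.neg hj hj') (by rw [hl, hj', sub_eq_add_neg])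

theorem isClosedSubsystem_univ : P.IsClosedSubsystem univ := ⟨fun _ _ _ => trivial, fun _ _ => trivial⟩

theorem isFace_univ : P.IsFace ht univ := fun _ _ _ _ _ _ _ => trivial

section Crystallographic

variable [P.IsCrystallographic]

theorem pairingIn_eq_add {i j l : ι} (h : P.root l = P.root i + P.root j) (m : ι) :
    P.pairingIn ℤ l m = P.pairingIn ℤ i m + P.pairingIn ℤ j m := by
  apply FaithfulSMul.algebraMap_injective ℤ k
  rw [map_add]
  simp only [algebraMap_pairingIn, ← root_coroot_eq_pairing, h, map_add, LinearMap.add_apply]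

theorem pairingIn_eq_sub {i j l : ι} (h : P.root l = P.root i - P.root j) (m : ι) :
    P.pairingIn ℤ l m = P.pairingIn ℤ i m - P.pairingIn ℤ j m := by
  have := pairingIn_eq_add (show P.root i = P.root l + P.root j by rw [h, sub_add_cancel]) m
  omega

theorem pairingIn_eq_neg {i j : ι} (h : P.root j = -P.root i) (m : ι) :
    P.pairingIn ℤ j m = -P.pairingIn ℤ i m := by
  apply FaithfulSMul.algebraMap_injective ℤ k
  rw [map_neg]
  simp only [algebraMap_pairingIn, ← root_coroot_eq_pairing, h, map_neg, LinearMap.neg_apply]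

/-- Adding to a root its reflection in an orthogonal root. -/
theorem exists_root_eq_sub_of_pairingIn_eq_zero {i j l : ι} (h0 : P.pairingIn ℤ i j = 0)
    (h : P.root l = P.root i + P.root j) : ∃ m, P.root m = P.root i - P.root j := by
  refine ⟨P.reflectionPerm j l, ?_⟩
  rw [root_reflectionPerm, P.reflection_apply_root' ℤ, pairingIn_eq_add h, h0, pairingIn_same, h]
  module

theorem exists_root_eq_add_of_pairingIn_eq_zero {i j l : ι} (h0 : P.pairingIn ℤ i j = 0)
    (h : P.root l = P.root i - P.root j) : ∃ m, P.root m = P.root i + P.root j := by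
  refine ⟨P.reflectionPerm j l, ?_⟩
  rw [root_reflectionPerm, P.reflection_apply_root' ℤ, pairingIn_eq_sub h, h0, pairingIn_same, h]
  module

variable [Finite ι]

/-- Otherwise `α + γ` would be a root of `Y` higher than `γ`. -/
theorem IsClosedSubsystem.pairingIn_nonneg (hY : P.IsClosedSubsystem Y) (h : P.IsHeight ht)
    (hγ : γ ∈ Y) (hpos : 0 < ht γ) (hmax : ∀ α ∈ Y, ht α ≤ ht γ) {α : ι} (hα : α ∈ Y)
    (hα0 : 0 < ht α) : 0 ≤ P.pairingIn ℤ α γ := by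
  by_contra! hlt
  obtain ⟨l, hl⟩ := P.root_add_root_mem_of_pairingIn_neg hlt (fun he => by
    have := h.neg he
    omega)
  have := hmax l (hY.add hα hγ hl)
  have := h.add hl
  omega

/-- A nonzero pairing is positive, so `γ - α` is a root, and maximality of `γ` makes it positive.
Conversely, if `α` were orthogonal to `γ` and `γ - α` a root, then `γ + α` would be a root, above
the maximal height. -/
theorem IsClosedSubsystem.pairingIn_ne_zero_iff (hY : P.IsClosedSubsystem Y) (h : P.IsHeight ht)
    (hγ : γ ∈ Y) (hpos : 0 < ht γ) (hmax : ∀ α ∈ Y, ht α ≤ ht γ) {α : ι} (hα : α ∈ Y)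
    (hα0 : 0 < ht α) (hne : α ≠ γ) :
    P.pairingIn ℤ α γ ≠ 0 ↔ ∃ β ∈ Y, 0 < ht β ∧ P.root γ = P.root α + P.root β := by
  constructor
  · intro h0
    have hp : 0 < P.pairingIn ℤ α γ :=
      lt_of_le_of_ne (hY.pairingIn_nonneg h hγ hpos hmax hα hα0) h0.symm
    rw [P.zero_lt_pairingIn_iff'] at hp
    obtain ⟨β, hβ⟩ := P.root_sub_root_mem_of_pairingIn_pos hp hne.symm
    refine ⟨β, hY.sub hγ hα hβ, ?_, by rw [hβ]; abel⟩
    have := h.sub hβ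
    have := h.ne_zero β
    by_contra hlt
    have := hmax α hα
    omega
  · rintro ⟨β, hβ, hβ0, he⟩ h0
    have h0' : P.pairingIn ℤ γ α = 0 := P.pairingIn_eq_zero_iff.mp h0
    obtain ⟨m, hm⟩ := exists_root_eq_add_of_pairingIn_eq_zero h0'
      (show P.root β = P.root γ - P.root α by rw [he]; abel)
    have := hmax m (hY.add hγ hα hm)
    have := h.add hm
    omega

/-- Roots of a closed subsystem orthogonal to its highest root are strongly orthogonal to it. -/
theorem IsClosedSubsystem.add_notMem_range (hY : P.IsClosedSubsystem Y) (h : P.IsHeight ht)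
    (hγ : γ ∈ Y) (hmax : ∀ α ∈ Y, ht α ≤ ht γ) {α : ι} (hα : α ∈ Y)
    (h0 : P.pairingIn ℤ α γ = 0) (l : ι) : P.root l ≠ P.root α + P.root γ := by
  intro hl
  obtain ⟨m, hm⟩ := exists_root_eq_sub_of_pairingIn_eq_zero h0 hl
  obtain ⟨m', hm'⟩ := P.exists_root_eq_neg m
  have h1 := hmax l (hY.add hα hγ hl)
  have h2 := hmax m' (hY.neg (hY.sub hα hγ hm) hm')
  have h3 := h.add hl
  have h4 := h.sub hm
  have h5 := h.neg hm'
  have h6 := h.ne_zero α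
  omega

theorem IsClosedSubsystem.sub_notMem_range (hY : P.IsClosedSubsystem Y) (h : P.IsHeight ht)
    (hγ : γ ∈ Y) (hmax : ∀ α ∈ Y, ht α ≤ ht γ) {α : ι} (hα : α ∈ Y)
    (h0 : P.pairingIn ℤ α γ = 0) (l : ι) : P.root l ≠ P.root α - P.root γ := by
  intro hl
  obtain ⟨m, hm⟩ := exists_root_eq_add_of_pairingIn_eq_zero h0 hl
  exact hY.add_notMem_range h hγ hmax hα h0 m hm

variable (P) in
/-- The roots of `Y` orthogonal to `γ`. -/
def orthogonalIn (Y : Set ι) (γ : ι) : Set ι := {α | α ∈ Y ∧ P.pairingIn ℤ α γ = 0}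

theorem IsClosedSubsystem.orthogonalIn (hY : P.IsClosedSubsystem Y) (γ : ι) :
    P.IsClosedSubsystem (P.orthogonalIn Y γ) where
  add hi hj hl := ⟨hY.add hi.1 hj.1 hl, by rw [pairingIn_eq_add hl, hi.2, hj.2, add_zero]⟩
  neg hi hl := ⟨hY.neg hi.1 hl, by rw [pairingIn_eq_neg hl, hi.2, neg_zero]⟩

/-- The pairings of the two summands with `γ` are nonnegative and add up to zero. -/
theorem IsFace.orthogonalIn (hf : P.IsFace ht Y) (hY : P.IsClosedSubsystem Y) (h : P.IsHeight ht)
    (hγ : γ ∈ Y) (hpos : 0 < ht γ) (hmax : ∀ α ∈ Y, ht α ≤ ht γ) :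
    P.IsFace ht (P.orthogonalIn Y γ) := by
  intro i j l hi hj hl hlY
  have hiY := hf hi hj hl hlY.1
  have hjY := hf hj hi (by rw [hl, add_comm]) hlY.1
  refine ⟨hiY, ?_⟩
  have h1 := hY.pairingIn_nonneg h hγ hpos hmax hiY hi
  have h2 := hY.pairingIn_nonneg h hγ hpos hmax hjY hj
  have h3 := pairingIn_eq_add hl γ
  rw [hlY.2] at h3
  omega

variable (P) in
/-- The Kostant cascade of a set of roots: successive roots of maximal height in the subsets
orthogonal to the preceding ones. -/
inductive IsCascade (ht : ι → ℤ) : Set ι → List ι → Prop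
  | nil {Y : Set ι} (h : ∀ i ∈ Y, ht i ≤ 0) : IsCascade ht Y []
  | cons {Y : Set ι} {γ : ι} {l : List ι} (mem : γ ∈ Y) (pos : 0 < ht γ)
      (max : ∀ α ∈ Y, ht α ≤ ht γ) (tail : IsCascade ht (P.orthogonalIn Y γ) l) :
      IsCascade ht Y (γ :: l)

theorem exists_isCascade (ht : ι → ℤ) (Y : Set ι) : ∃ l, P.IsCascade ht Y l := by
  induction hn : Y.ncard using Nat.strong_induction_on generalizing Y with
  | _ n ih =>
  by_cases hY : ∀ i ∈ Y, ht i ≤ 0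
  · exact ⟨[], .nil hY⟩
  push Not at hY
  obtain ⟨i, hi, hi0⟩ := hY
  obtain ⟨γ, hγ, hmax⟩ := Y.toFinite.exists_maximalFor ht Y ⟨i, hi⟩
  have hmax' : ∀ α ∈ Y, ht α ≤ ht γ := fun α hα => by
    by_contra! hlt
    exact hlt.not_ge (hmax hα hlt.le)
  have hlt : (P.orthogonalIn Y γ).ncard < n := by
    rw [← hn]
    refine ncard_lt_ncard ⟨fun α hα => hα.1, fun hsub => ?_⟩ Y.toFinite
    have := (hsub hγ).2
    rw [pairingIn_same] at this
    omega
  obtain ⟨l, hl⟩ := ih _ hlt _ rfl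
  exact ⟨γ :: l, .cons hγ (hi0.trans_le (hmax' i hi)) hmax' hl⟩

namespace IsCascade

variable {l : List ι}

theorem mem_of_mem (hl : P.IsCascade ht Y l) : ∀ γ ∈ l, γ ∈ Y := by
  induction hl with
  | nil => simp
  | cons mem pos max tail ih =>
    rintro δ (_ | ⟨_, hδ⟩)
    · exact mem
    · exact (ih δ hδ).1

theorem pos_of_mem (hl : P.IsCascade ht Y l) : ∀ γ ∈ l, 0 < ht γ := by
  induction hl with
  | nil => simp
  | cons mem pos max tail ih =>
    rintro δ (_ | ⟨_, hδ⟩)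
    · exact pos
    · exact ih δ hδ

theorem pairingIn_eq_zero (hl : P.IsCascade ht Y l) :
    l.Pairwise fun γ δ => P.pairingIn ℤ δ γ = 0 := by
  induction hl with
  | nil => exact List.Pairwise.nil
  | cons mem pos max tail ih => exact ih.cons fun δ hδ => (tail.mem_of_mem δ hδ).2

theorem nodup (hl : P.IsCascade ht Y l) : l.Nodup :=
  hl.pairingIn_eq_zero.imp fun {γ δ} h he => by
    subst he
    rw [pairingIn_same] at h
    omega

/-- Distinct members of a cascade are strongly orthogonal. -/
theorem stronglyOrthogonal (hl : P.IsCascade ht Y l) (hY : P.IsClosedSubsystem Y)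
    (h : P.IsHeight ht) {γ δ : ι} (hγ : γ ∈ l) (hδ : δ ∈ l) (hne : γ ≠ δ) :
    P.pairingIn ℤ γ δ = 0 ∧ ∀ m, P.root m ≠ P.root γ + P.root δ ∧ P.root m ≠ P.root γ - P.root δ := by
  induction hl with
  | nil => simp at hγ
  | @cons Y ε l mem pos max tail ih =>
    have key : ∀ δ ∈ l, P.pairingIn ℤ δ ε = 0 ∧
        ∀ m, P.root m ≠ P.root δ + P.root ε ∧ P.root m ≠ P.root δ - P.root ε := by
      intro δ hδ
      have hmem := tail.mem_of_mem δ hδ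
      exact ⟨hmem.2, fun m => ⟨hY.add_notMem_range h mem max hmem.1 hmem.2 m,
        hY.sub_notMem_range h mem max hmem.1 hmem.2 m⟩⟩
    rcases List.mem_cons.mp hγ with rfl | hγ' <;> rcases List.mem_cons.mp hδ with rfl | hδ'
    · exact absurd rfl hne
    · obtain ⟨h1, h2⟩ := key δ hδ'
      refine ⟨P.pairingIn_eq_zero_iff.mp h1, fun m => ⟨fun hm => (h2 m).1 (by rw [hm, add_comm]),
        fun hm => ?_⟩⟩
      obtain ⟨m', hm'⟩ := P.exists_root_eq_neg m
      exact (h2 m').2 (by rw [hm', hm, neg_sub])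
    · exact key γ hγ'
    · exact ih (hY.orthogonalIn ε) hγ' hδ'

/-- Every positive root of `Y` is a member of the cascade or a positive summand of one. -/
theorem exists_mem_eq_or_add (hl : P.IsCascade ht Y l) (hY : P.IsClosedSubsystem Y)
    (h : P.IsHeight ht) {α : ι} (hα : α ∈ Y) (hα0 : 0 < ht α) :
    ∃ γ ∈ l, α = γ ∨ ∃ β ∈ Y, 0 < ht β ∧ P.root γ = P.root α + P.root β := by
  induction hl with
  | nil h => exact absurd hα0 (h α hα).not_gt
  | @cons Y γ l mem pos max tail ih =>
    by_cases h0 : P.pairingIn ℤ α γ = 0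
    · obtain ⟨δ, hδ, hor⟩ := ih (hY.orthogonalIn γ) ⟨hα, h0⟩
      refine ⟨δ, List.mem_cons_of_mem _ hδ, hor.imp_right ?_⟩
      rintro ⟨β, hβ, hβ'⟩
      exact ⟨β, hβ.1, hβ'⟩
    · refine ⟨γ, List.mem_cons_self, or_iff_not_imp_left.mpr fun hne => ?_⟩
      exact (hY.pairingIn_ne_zero_iff h mem pos max hα hα0 hne).mp h0

theorem map_neg (hl : P.IsCascade ht Y l) (hY : P.IsClosedSubsystem Y) (h : P.IsHeight ht) :
    P.IsCascade (-ht) Y (l.map fun i => P.reflectionPerm i i) := by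
  have hneg : ∀ i, P.root (P.reflectionPerm i i) = -P.root i := fun i => by
    rw [root_reflectionPerm, reflection_apply_self]
  induction hl with
  | nil h0 =>
    refine .nil fun i hi => ?_
    have := h0 _ (hY.neg hi (hneg i))
    have := h.neg (hneg i)
    simp only [Pi.neg_apply]
    omega
  | @cons Y γ l mem pos max tail ih =>
    refine .cons (hY.neg mem (hneg γ)) ?_ (fun α hα => ?_) ?_
    · have := h.neg (hneg γ)
      simp only [Pi.neg_apply]
      omega
    · have := max _ (hY.neg hα (hneg α))
      have h1 := h.neg (hneg γ)
      have h2 := h.neg (hneg α)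
      simp only [Pi.neg_apply]
      omega
    · have : P.orthogonalIn Y (P.reflectionPerm γ γ) = P.orthogonalIn Y γ := by
        ext α
        simp [RootPairing.orthogonalIn]
      rw [this]
      exact ih (hY.orthogonalIn γ)

/-- The final segments of a cascade are cascades of closed faces. -/
theorem exists_drop (hl : P.IsCascade ht Y l) (hY : P.IsClosedSubsystem Y) (h : P.IsHeight ht)
    (hf : P.IsFace ht Y) (j : ℕ) :
    ∃ Y', P.IsClosedSubsystem Y' ∧ P.IsFace ht Y' ∧ P.IsCascade ht Y' (l.drop j) := by
  induction hl generalizing j with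
  | @nil Y h0 => exact ⟨Y, hY, hf, by simpa using IsCascade.nil h0⟩
  | @cons Y γ l mem pos max tail ih =>
    rcases j with _ | j
    · exact ⟨Y, hY, hf, .cons mem pos max tail⟩
    · exact ih (hY.orthogonalIn γ) (hf.orthogonalIn hY h mem pos max) j

end IsCascade

end Crystallographic

end RootPairing

/-! ### Simple roots complementing a cascade to a basis. -/

namespace RootPairing

open Function Set

variable {ι k M N : Type*} [Field k] [CharZero k] [AddCommGroup M] [Module k M]
  [AddCommGroup N] [Module k N] {P : RootPairing ι k M N}

namespace Base

variable (b : P.Base)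

/-- The coefficients of a root with respect to the simple roots. -/
noncomputable def coeff (i : ι) : ι → ℤ := (b.exists_root_eq_sum_int i).choose

theorem root_eq_sum_coeff (i : ι) : P.root i = ∑ j ∈ b.support, b.coeff i j • P.root j :=
  (b.exists_root_eq_sum_int i).choose_spec.2.2

theorem coeff_eq_of_root_eq {i : ι} {f : ι → ℤ} (h : P.root i = ∑ j ∈ b.support, f j • P.root j)
    {s : ι} (hs : s ∈ b.support) : b.coeff i s = f s := by
  have hli := linearIndepOn_finset_iff.mp (b.linearIndepOn_root.restrict_scalars' ℤ)
    (fun j => b.coeff i j - f j) (by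
      simp only [sub_smul, Finset.sum_sub_distrib]
      rw [← b.root_eq_sum_coeff, ← h, sub_self]) s hs
  exact sub_eq_zero.mp hli

theorem coeff_eq_add {i j l s : ι} (h : P.root l = P.root i + P.root j) (hs : s ∈ b.support) :
    b.coeff l s = b.coeff i s + b.coeff j s :=
  b.coeff_eq_of_root_eq (f := fun s => b.coeff i s + b.coeff j s) (by
    simp only [add_smul, Finset.sum_add_distrib]
    rw [h, ← b.root_eq_sum_coeff, ← b.root_eq_sum_coeff]) hs

theorem coeff_of_mem_support [DecidableEq ι] {i s : ι} (hi : i ∈ b.support) (hs : s ∈ b.support) :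
    b.coeff i s = if s = i then 1 else 0 :=
  b.coeff_eq_of_root_eq (f := fun s => if s = i then 1 else 0) (by simp [hi]) hs

theorem coeff_nonneg_or_nonpos (i : ι) : (∀ s, 0 ≤ b.coeff i s) ∨ ∀ s, b.coeff i s ≤ 0 :=
  (b.exists_root_eq_sum_int i).choose_spec.2.1.imp (fun h s => h.le s) fun h s => h.le s

theorem coeff_nonneg {i : ι} (hi : 0 < b.height i) (s : ι) : 0 ≤ b.coeff i s := by
  rcases b.coeff_nonneg_or_nonpos i with h | h
  · exact h s
  · have : b.height i ≤ 0 := Finset.sum_nonpos fun j _ => h j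
    omega

/-- A positive root is built by adding simple roots one at a time; the face property puts each
summand back in `Y`. -/
theorem coeff_mem_of_isFace {Y : Set ι} (hf : P.IsFace b.height Y) [P.IsCrystallographic]
    [Finite ι] {α s : ι} (hα : α ∈ Y) (hα0 : 0 < b.height α) (hs : s ∈ b.support)
    (h : b.coeff α s ≠ 0) : s ∈ Y := by
  classical
  have H : 0 < b.height α ∧ (α ∈ Y → b.coeff α s ≠ 0 → s ∈ Y) := by
    refine IsPos.induction_on_add (p := fun α => 0 < b.height α ∧ (α ∈ Y → b.coeff α s ≠ 0 → s ∈ Y))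
      hα0 (fun i hi => ⟨isPos_of_mem_support hi, fun hiY hc => ?_⟩)
      (fun i j l hl hi hj => ⟨?_, fun hlY hc => ?_⟩)
    · rw [b.coeff_of_mem_support hi hs] at hc
      by_cases hsi : s = i
      · rwa [hsi]
      · simp [hsi] at hc
    · rw [b.height_add hl, height_one_of_mem_support hj]
      omega
    · have hj0 : 0 < b.height j := isPos_of_mem_support hj
      rw [b.coeff_eq_add hl hs, b.coeff_of_mem_support hj hs] at hc
      by_cases hsj : s = j
      · rw [hsj]
        exact hf hj0 hi.1 (by rw [hl, add_comm]) hlY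
      · refine hi.2 (hf hi.1 hj0 hl hlY) ?_
        simpa [hsj] using hc
  exact H.2 hα h

variable [P.IsCrystallographic]

theorem pairingIn_eq_sum_coeff (i m : ι) :
    P.pairingIn ℤ i m = ∑ s ∈ b.support, b.coeff i s * P.pairingIn ℤ s m := by
  apply FaithfulSMul.algebraMap_injective ℤ k
  simp only [map_sum, map_mul, algebraMap_pairingIn, ← root_coroot_eq_pairing]
  conv_lhs => rw [b.root_eq_sum_coeff i]
  simp

variable [Finite ι]

theorem pairingIn_nonpos_of_coeff_eq_zero {δ s : ι} (hδ : 0 < b.height δ) (hs : s ∈ b.support)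
    (h : b.coeff δ s = 0) : P.pairingIn ℤ δ s ≤ 0 := by
  rw [b.pairingIn_eq_sum_coeff]
  refine Finset.sum_nonpos fun t ht => ?_
  rcases eq_or_ne t s with rfl | hts
  · simp [h]
  · exact mul_nonpos_of_nonneg_of_nonpos (b.coeff_nonneg hδ t) (b.pairingIn_le_zero_of_ne hts ht hs)

theorem pairingIn_neg_of_coeff_eq_zero {δ s t : ι} (hδ : 0 < b.height δ) (hs : s ∈ b.support)
    (h : b.coeff δ s = 0) (ht : t ∈ b.support) (ht0 : b.coeff δ t ≠ 0)
    (hts : P.pairingIn ℤ t s ≠ 0) : P.pairingIn ℤ δ s < 0 := by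
  rw [b.pairingIn_eq_sum_coeff]
  have hne : ∀ {t}, b.coeff δ t ≠ 0 → t ≠ s := by
    rintro t h0 rfl
    exact h0 h
  refine Finset.sum_neg' (fun t ht => ?_) ⟨t, ht, ?_⟩
  · rcases eq_or_ne t s with rfl | hts
    · simp [h]
    · exact mul_nonpos_of_nonneg_of_nonpos (b.coeff_nonneg hδ t)
        (b.pairingIn_le_zero_of_ne hts ht hs)
  · have h1 := b.coeff_nonneg hδ t
    have h2 := b.pairingIn_le_zero_of_ne (hne ht0) ht hs
    exact mul_neg_of_pos_of_neg (by omega) (by omega)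

open Classical in
/-- The simple roots in `Y` that are not orthogonal to `γ`. -/
noncomputable def ends (Y : Set ι) (γ : ι) : Finset ι :=
  b.support.filter fun s => s ∈ Y ∧ P.pairingIn ℤ s γ ≠ 0

variable {b} {Y : Set ι} {γ : ι}

theorem mem_ends {s : ι} : s ∈ b.ends Y γ ↔ s ∈ b.support ∧ s ∈ Y ∧ P.pairingIn ℤ s γ ≠ 0 := by
  simp [ends]

theorem one_le_of_mem_ends (hY : P.IsClosedSubsystem Y) (hγ : γ ∈ Y) (hpos : 0 < b.height γ)
    (hmax : ∀ α ∈ Y, b.height α ≤ b.height γ) {s : ι} (hs : s ∈ b.ends Y γ) :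
    1 ≤ b.coeff γ s ∧ 1 ≤ P.pairingIn ℤ s γ := by
  obtain ⟨hs, hsY, h0⟩ := mem_ends.mp hs
  have hp := hY.pairingIn_nonneg b.isHeight hγ hpos hmax hsY (isPos_of_mem_support hs)
  refine ⟨?_, by omega⟩
  by_contra hlt
  have hc := b.coeff_nonneg hpos s
  have := b.pairingIn_nonpos_of_coeff_eq_zero hpos hs (by omega)
  have h1 : 0 < P.pairingIn ℤ s γ := by omega
  rw [P.zero_lt_pairingIn_iff'] at h1
  omega

/-- This expands the pairing of `γ` with its own coroot along the simple roots. With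
`one_le_of_mem_ends` it leaves at most two ends; two occur as for the highest root of type `A`. -/
theorem sum_ends (hf : P.IsFace b.height Y) (hγ : γ ∈ Y) (hpos : 0 < b.height γ) :
    ∑ s ∈ b.ends Y γ, b.coeff γ s * P.pairingIn ℤ s γ = 2 := by
  rw [← P.pairingIn_same ℤ γ, b.pairingIn_eq_sum_coeff]
  refine Finset.sum_subset (fun s hs => (mem_ends.mp hs).1) fun s hs hs' => ?_
  by_contra hne
  exact hs' (mem_ends.mpr ⟨hs, b.coeff_mem_of_isFace hf hγ hpos hs (left_ne_zero_of_mul hne),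
    right_ne_zero_of_mul hne⟩)

open Classical in
theorem ends_eq_singleton_or_pair (hY : P.IsClosedSubsystem Y) (hf : P.IsFace b.height Y)
    (hγ : γ ∈ Y) (hpos : 0 < b.height γ) (hmax : ∀ α ∈ Y, b.height α ≤ b.height γ) :
    (∃ c, b.ends Y γ = {c}) ∨ ∃ c d, c ≠ d ∧ b.ends Y γ = {c, d} ∧
      b.coeff γ c = 1 ∧ P.pairingIn ℤ c γ = 1 ∧ b.coeff γ d = 1 ∧ P.pairingIn ℤ d γ = 1 := by
  classical
  have hsum := sum_ends hf hγ hpos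
  have hone : ∀ s ∈ b.ends Y γ, 1 ≤ b.coeff γ s * P.pairingIn ℤ s γ := fun s hs => by
    obtain ⟨h1, h2⟩ := one_le_of_mem_ends hY hγ hpos hmax hs
    nlinarith
  have hcard : ((b.ends Y γ).card : ℤ) ≤ 2 := by
    rw [← hsum, Finset.card_eq_sum_ones]
    push_cast
    exact Finset.sum_le_sum hone
  have hcard' : (b.ends Y γ).card ≠ 0 := by
    intro h
    rw [Finset.card_eq_zero.mp h] at hsum
    simp at hsum
  obtain h | h : (b.ends Y γ).card = 1 ∨ (b.ends Y γ).card = 2 := by omega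
  · exact .inl (Finset.card_eq_one.mp h)
  · obtain ⟨c, d, hcd, he⟩ := Finset.card_eq_two.mp h
    refine .inr ⟨c, d, hcd, he, ?_⟩
    rw [he, Finset.sum_pair hcd] at hsum
    obtain ⟨h1, h2⟩ := one_le_of_mem_ends hY hγ hpos hmax (s := c) (by simp [he])
    obtain ⟨h3, h4⟩ := one_le_of_mem_ends hY hγ hpos hmax (s := d) (by simp [he])
    refine ⟨?_, ?_, ?_, ?_⟩ <;> nlinarith

variable (P) in
/-- At most one element of `S` pairs positively with each member of the cascade, and then as in
a simply laced root system. -/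
def _root_.RootPairing.IsSparse (l : List ι) (S : Finset ι) : Prop :=
  ∀ γ ∈ l, ∀ s ∈ S, 0 < P.pairingIn ℤ s γ →
    (∀ t ∈ S, 0 < P.pairingIn ℤ t γ → t = s) ∧ P.pairingIn ℤ γ s ≤ 1

variable {l : List ι} {S : Finset ι} {c d : ι}

/-- If both ends `c`, `d` of `γ` had neighbours in `S`, then `δ = γ - c - d` would be a root
orthogonal to `γ`, pairing positively with both neighbours. A cascade member `g` above or equal to
`δ` pairs negatively with `c` and `d`, so `g + c + d` is a root of `Y`. Maximality of `γ` forces `g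
= δ`, which contradicts sparsity. -/
theorem false_of_adjacent (hY : P.IsClosedSubsystem Y) (hf : P.IsFace b.height Y)
    (hγ : γ ∈ Y) (hpos : 0 < b.height γ) (hmax : ∀ α ∈ Y, b.height α ≤ b.height γ)
    (hl : P.IsCascade b.height (P.orthogonalIn Y γ) l) (hS : S ⊆ b.support)
    (hSY : ∀ s ∈ S, s ∈ P.orthogonalIn Y γ) (hsp : P.IsSparse l S)
    (hcd : c ≠ d) (hc : c ∈ b.support) (hd : d ∈ b.support) (hcY : c ∈ Y) (hdY : d ∈ Y)
    (hcγ : P.pairingIn ℤ c γ = 1) (hdγ : P.pairingIn ℤ d γ = 1) {α β : ι} (hα : α ∈ S) (hβ : β ∈ S)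
    (hαc : P.pairingIn ℤ α c ≠ 0) (hβd : P.pairingIn ℤ β d ≠ 0) : False := by
  have hY' := hY.orthogonalIn γ
  have hf' := hf.orthogonalIn hY b.isHeight hγ hpos hmax
  have ne_of : ∀ {x}, x ∈ S → ∀ {c}, P.pairingIn ℤ c γ = 1 → c ≠ x := by
    rintro x hx c hc1 rfl
    have := (hSY _ hx).2
    omega
  have hγS : ∀ {x}, x ∈ S → P.pairingIn ℤ γ x = 0 := fun hx =>
    P.pairingIn_eq_zero_iff.mp (hSY _ hx).2
  have adj : ∀ {x}, x ∈ S → ∀ {c}, c ∈ b.support → P.pairingIn ℤ c γ = 1 →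
      P.pairingIn ℤ c x ≤ 0 := fun hx c hc hcγ =>
    b.pairingIn_le_zero_of_ne (ne_of hx hcγ) hc (hS hx)
  have adj' : ∀ {x}, x ∈ S → ∀ {c}, c ∈ b.support → P.pairingIn ℤ c γ = 1 →
      P.pairingIn ℤ x c ≠ 0 → P.pairingIn ℤ c x < 0 := fun hx c hc hcγ h0 =>
    lt_of_le_of_ne (adj hx hc hcγ) fun h => h0 (P.pairingIn_eq_zero_iff.mp h)
  have hneg : P.pairingIn ℤ c d ≤ 0 := b.pairingIn_le_zero_of_ne hcd hc hd
  have hpc : 0 < P.pairingIn ℤ γ c := (P.zero_lt_pairingIn_iff' ℤ).mp (by omega)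
  have hpd : 0 < P.pairingIn ℤ γ d := (P.zero_lt_pairingIn_iff' ℤ).mp (by omega)
  obtain ⟨e, he⟩ := P.root_sub_root_mem_of_pairingIn_pos hpc (by
    rintro rfl
    rw [pairingIn_same] at hcγ
    omega)
  have hed : 0 < P.pairingIn ℤ e d := by
    rw [pairingIn_eq_sub he]
    omega
  obtain ⟨δ, hδ⟩ := P.root_sub_root_mem_of_pairingIn_pos hed (by
    rintro rfl
    have h1 := pairingIn_eq_sub he α
    have h2 := hγS hα
    have h3 := adj' hα hc hcγ hαc
    have h4 := adj hα hd hdγ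
    omega)
  have hpair : ∀ x, P.pairingIn ℤ δ x =
      P.pairingIn ℤ γ x - P.pairingIn ℤ c x - P.pairingIn ℤ d x := fun x => by
    rw [pairingIn_eq_sub hδ, pairingIn_eq_sub he]
  have htc := height_one_of_mem_support hc
  have htd := height_one_of_mem_support hd
  have hte := b.height_sub he
  have htδ := b.height_sub hδ
  have hδ0 : 0 < b.height δ := by
    have := b.height_ne_zero e
    have := b.height_ne_zero δ
    omega
  have hδY : δ ∈ P.orthogonalIn Y γ := by
    refine ⟨hY.sub (hY.sub hγ hcY he) hdY hδ, ?_⟩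
    rw [hpair, pairingIn_same]
    omega
  have hδα : 0 < P.pairingIn ℤ δ α := by
    have h3 := adj' hα hc hcγ hαc
    have h4 := adj hα hd hdγ
    rw [hpair, hγS hα]
    omega
  have hδβ : 0 < P.pairingIn ℤ δ β := by
    have h3 := adj hβ hc hcγ
    have h4 := adj' hβ hd hdγ hβd
    rw [hpair, hγS hβ]
    omega
  have hcoeff : ∀ {x}, x ∈ S → 0 < P.pairingIn ℤ δ x → b.coeff δ x ≠ 0 := fun hx h h0 =>
    (b.pairingIn_nonpos_of_coeff_eq_zero hδ0 (hS hx) h0).not_gt h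
  -- An end of `γ` is not orthogonal to `γ`, so by the face property it occurs in no positive root
  -- orthogonal to `γ`.
  have hzero : ∀ {c}, c ∈ b.support → P.pairingIn ℤ c γ = 1 → ∀ ε ∈ P.orthogonalIn Y γ,
      0 < b.height ε → b.coeff ε c = 0 := by
    intro c hc hcγ ε hε hε0
    by_contra h
    have := (b.coeff_mem_of_isFace hf' hε hε0 hc h).2
    omega
  obtain ⟨g, hg, hor⟩ := hl.exists_mem_eq_or_add hY' b.isHeight hδY hδ0
  have hgneg : ∀ {c x}, c ∈ b.support → P.pairingIn ℤ c γ = 1 → x ∈ S → P.pairingIn ℤ x c ≠ 0 →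
      0 < P.pairingIn ℤ δ x → P.pairingIn ℤ g c < 0 := by
    intro c x hc hcγ hx hxc hδx
    have h1 := b.pairingIn_neg_of_coeff_eq_zero hδ0 hc (hzero hc hcγ δ hδY hδ0) (hS hx)
      (hcoeff hx hδx) hxc
    rcases hor with rfl | ⟨ε, hε, hε0, hsum⟩
    · exact h1
    · have := b.pairingIn_nonpos_of_coeff_eq_zero hε0 hc (hzero hc hcγ ε hε hε0)
      rw [pairingIn_eq_add hsum]
      omega
  have hg0 := hl.pos_of_mem g hg
  obtain ⟨i, hi⟩ := P.root_add_root_mem_of_pairingIn_neg (hgneg hc hcγ hα hαc hδα) (fun h => by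
    have := b.isHeight.neg h
    omega)
  have hti := b.height_add hi
  obtain ⟨j, hj⟩ := P.root_add_root_mem_of_pairingIn_neg (i := i) (j := d) (by
      rw [pairingIn_eq_add hi]
      have := hgneg hd hdγ hβ hβd hδβ
      omega) (fun h => by
    have := b.isHeight.neg h
    omega)
  have htj := b.height_add hj
  have := hmax j (hY.add (hY.add (hl.mem_of_mem g hg).1 hcY hi) hdY hj)
  -- If `g = δ`, sparsity identifies the two neighbours, but then `c` and `d` each contribute at
  -- least `1` to a pairing of `δ` bounded by `1`. If `g = δ + ε`, then `g + c + d` is higher than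
  -- `γ`.
  rcases hor with rfl | ⟨ε, hε, hε0, hsum⟩
  · obtain ⟨h1, h2⟩ := hsp δ hg α hα ((P.zero_lt_pairingIn_iff' ℤ).mp hδα)
    obtain rfl := h1 β hβ ((P.zero_lt_pairingIn_iff' ℤ).mp hδβ)
    rw [hpair, hγS hα] at h2
    have h3 := adj' hα hc hcγ hαc
    have h4 := adj' hβ hd hdγ hβd
    omega
  · have := b.height_add hsum
    omega

/-- Reflecting `γ` in `c` keeps the positive coefficient at `d`, so the new coefficient at `c`,
which is `1` minus the pairing, cannot be negative. -/
theorem pairingIn_le_one_of_coeff {γ c d : ι} (hcd : c ≠ d) (hc : c ∈ b.support)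
    (hd : d ∈ b.support) (h1 : b.coeff γ c = 1) (h2 : 0 < b.coeff γ d) :
    P.pairingIn ℤ γ c ≤ 1 := by
  classical
  have hr : P.root (P.reflectionPerm c γ) =
      ∑ s ∈ b.support, (b.coeff γ s - P.pairingIn ℤ γ c * b.coeff c s) • P.root s := by
    rw [root_reflectionPerm, P.reflection_apply_root' ℤ]
    simp only [sub_smul, Finset.sum_sub_distrib, mul_smul, ← Finset.smul_sum]
    rw [← b.root_eq_sum_coeff, ← b.root_eq_sum_coeff]
  have hrc := b.coeff_eq_of_root_eq hr hc
  have hrd := b.coeff_eq_of_root_eq hr hd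
  rw [b.coeff_of_mem_support hc hc, if_pos rfl] at hrc
  rw [b.coeff_of_mem_support hc hd, if_neg hcd.symm] at hrd
  rcases b.coeff_nonneg_or_nonpos (P.reflectionPerm c γ) with h | h
  · have := h c
    omega
  · have := h d
    omega

variable [P.IsRootSystem]

theorem toWeightBasis_coord_root (b : P.Base) (i : ι) (s : b.support) :
    b.toWeightBasis.coord s (P.root i) = b.coeff i s := by
  classical
  conv_lhs => rw [b.root_eq_sum_coeff i]
  rw [map_sum, Finset.sum_eq_single s.1]
  · simp [← Int.cast_smul_eq_zsmul k]
  · intro j hj hjs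
    have : b.toWeightBasis.repr (P.root j) s = 0 := by
      rw [b.toWeightBasis_repr_root ⟨j, hj⟩, Finsupp.single_eq_of_ne]
      rintro rfl
      exact hjs rfl
    simp [this, ← Int.cast_smul_eq_zsmul k]
  · exact fun h => absurd s.2 h

/-- Passing to the roots orthogonal to `γ` loses the ends of `γ`. One end is paid for by `γ` itself;
if there are two, one of them joins `S`, chosen orthogonal to the earlier elements by
`false_of_adjacent`. Sparsity is carried only to feed that lemma. -/
theorem exists_sparse (hl : P.IsCascade b.height Y l) (hY : P.IsClosedSubsystem Y)
    (hf : P.IsFace b.height Y) :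
    ∃ S ⊆ b.support, (∀ s ∈ S, s ∈ Y) ∧ (∀ s ∈ S, ∀ t ∈ S, s ≠ t → P.pairingIn ℤ s t = 0) ∧
      P.IsSparse l S ∧ (∀ s ∈ S, s ∉ l) ∧ LinearIndepOn k P.root ({γ | γ ∈ l} ∪ S) ∧
      S.card + l.length = {s | s ∈ b.support ∧ s ∈ Y}.ncard := by
  classical
  induction hl with
  | @nil Y h =>
    refine ⟨∅, by simp, by simp, by simp, fun γ hγ => by simp at hγ, by simp, by simp, ?_⟩
    have : {s | s ∈ b.support ∧ s ∈ Y} = ∅ := by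
      ext s
      simp only [mem_ofPred_eq, mem_empty_iff_false, iff_false, not_and]
      intro hs hsY
      have h0 : 0 < b.height s := isPos_of_mem_support hs
      have := h s hsY
      omega
    simp [this]
  | @cons Y γ l mem pos max tail ih =>
    have hf' := hf.orthogonalIn hY b.isHeight mem pos max
    obtain ⟨S, hS, hSY, hSorth, hsp, hSl, hli, hcard⟩ := ih (hY.orthogonalIn γ) hf'
    have hsplit : {s | s ∈ b.support ∧ s ∈ Y}.ncard =
        {s | s ∈ b.support ∧ s ∈ P.orthogonalIn Y γ}.ncard + (b.ends Y γ).card := by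
      rw [← ncard_coe_finset, ← ncard_union_eq]
      · congr 1
        ext s
        simp only [mem_ofPred_eq, mem_union, Finset.mem_coe, mem_ends, RootPairing.orthogonalIn]
        tauto
      · rw [Set.disjoint_left]
        rintro s ⟨_, _, h⟩ hs
        exact (mem_ends.mp hs).2.2 h
    have hT : ∀ t ∈ {γ | γ ∈ l} ∪ (S : Set ι), t ∈ P.orthogonalIn Y γ ∧ 0 < b.height t := by
      rintro t (ht | ht)
      · exact ⟨tail.mem_of_mem t ht, tail.pos_of_mem t ht⟩
      · exact ⟨hSY t ht, isPos_of_mem_support (hS ht)⟩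
    have hγl : ∀ δ ∈ {γ | γ ∈ l} ∪ (S : Set ι), δ ≠ γ := by
      rintro δ hδ rfl
      have := (hT _ hδ).1.2
      rw [pairingIn_same] at this
      omega
    have hker : ∀ z ∈ Submodule.span k (P.root '' ({γ | γ ∈ l} ∪ S)),
        P.toLinearMap z (P.coroot γ) = 0 := by
      intro z hz
      induction hz using Submodule.span_induction with
      | mem x hx =>
        obtain ⟨t, ht, rfl⟩ := hx
        rw [root_coroot_eq_pairing, ← P.algebraMap_pairingIn ℤ, (hT t ht).1.2, map_zero]
      | zero => simp
      | add x y _ _ hx hy => rw [map_add, LinearMap.add_apply, hx, hy, add_zero]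
      | smul a x _ hx => rw [map_smul, LinearMap.smul_apply, hx, smul_zero]
    have hins : {δ | δ ∈ γ :: l} ∪ (S : Set ι) = insert γ ({γ | γ ∈ l} ∪ S) := by
      ext δ
      simp only [List.mem_cons, mem_union, mem_ofPred_eq, mem_insert_iff]
      tauto
    have hli' : LinearIndepOn k P.root (insert γ ({γ | γ ∈ l} ∪ (S : Set ι))) := by
      refine hli.insert fun h => ?_
      have := hker _ h
      rw [root_coroot_eq_pairing, pairing_same] at this
      exact two_ne_zero this
    have hspγ : ∀ s ∈ S, ¬ 0 < P.pairingIn ℤ s γ := fun s hs h => by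
      have := (hSY s hs).2
      omega
    rcases ends_eq_singleton_or_pair hY hf mem pos max with ⟨c, hc⟩ | ⟨c, d, hcd, he, hc1, hc2, hd1, hd2⟩
    · refine ⟨S, hS, fun s hs => (hSY s hs).1, hSorth, ?_, ?_, ?_, ?_⟩
      · rintro δ hδ s hs h0
        rcases List.mem_cons.mp hδ with rfl | hδ
        · exact absurd h0 (hspγ s hs)
        · exact hsp δ hδ s hs h0
      · intro s hs
        rw [List.mem_cons, not_or]
        exact ⟨hγl s (.inr hs), hSl s hs⟩
      · rwa [hins]
      · rw [hsplit, hc, ← hcard, List.length_cons, Finset.card_singleton, add_assoc]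
    · have key : ∀ c d, c ≠ d → b.ends Y γ = {c, d} → b.coeff γ c = 1 → P.pairingIn ℤ c γ = 1 →
          b.coeff γ d = 1 → P.pairingIn ℤ d γ = 1 → (∀ α ∈ S, P.pairingIn ℤ α c = 0) →
          ∃ S ⊆ b.support, (∀ s ∈ S, s ∈ Y) ∧
            (∀ s ∈ S, ∀ t ∈ S, s ≠ t → P.pairingIn ℤ s t = 0) ∧
            P.IsSparse (γ :: l) S ∧ (∀ s ∈ S, s ∉ γ :: l) ∧
            LinearIndepOn k P.root ({δ | δ ∈ γ :: l} ∪ S) ∧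
            S.card + (γ :: l).length = {s | s ∈ b.support ∧ s ∈ Y}.ncard := by
        intro c d hcd he hc1 hc2 hd1 hd2 hcS
        obtain ⟨hc, hcY, -⟩ := mem_ends.mp (show c ∈ b.ends Y γ by simp [he])
        obtain ⟨hd, hdY, -⟩ := mem_ends.mp (show d ∈ b.ends Y γ by simp [he])
        have hcY' : c ∉ P.orthogonalIn Y γ := fun h => by
          have := h.2
          omega
        have hcS' : c ∉ S := fun h => hcY' (hSY c h)
        have hcγ : c ≠ γ := by
          rintro rfl
          rw [pairingIn_same] at hc2
          omega
        have hneg : ∀ δ ∈ l, ¬ 0 < P.pairingIn ℤ c δ := by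
          intro δ hδ h
          rw [P.zero_lt_pairingIn_iff'] at h
          refine (b.pairingIn_nonpos_of_coeff_eq_zero (tail.pos_of_mem δ hδ) hc ?_).not_gt h
          by_contra h0
          exact hcY' (b.coeff_mem_of_isFace hf' (tail.mem_of_mem δ hδ) (tail.pos_of_mem δ hδ) hc h0)
        refine ⟨insert c S, Finset.insert_subset hc hS, ?_, ?_, ?_, ?_, ?_, ?_⟩
        · intro s hs
          rcases Finset.mem_insert.mp hs with rfl | hs
          · exact hcY
          · exact (hSY s hs).1
        · intro s hs t ht hst
          rcases Finset.mem_insert.mp hs with rfl | hs' <;>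
            rcases Finset.mem_insert.mp ht with rfl | ht'
          · exact absurd rfl hst
          · exact P.pairingIn_eq_zero_iff.mp (hcS t ht')
          · exact hcS s hs'
          · exact hSorth s hs' t ht' hst
        · intro δ hδ s hs h0
          rcases List.mem_cons.mp hδ with rfl | hδ <;>
            rcases Finset.mem_insert.mp hs with rfl | hs
          · refine ⟨fun t ht h => ?_, pairingIn_le_one_of_coeff hcd hc hd hc1 (by omega)⟩
            rcases Finset.mem_insert.mp ht with rfl | ht
            · rfl
            · exact absurd h (hspγ t ht)
          · exact absurd h0 (hspγ s hs)
          · exact absurd h0 (hneg δ hδ)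
          · obtain ⟨h1, h2⟩ := hsp δ hδ s hs h0
            refine ⟨fun t ht h => ?_, h2⟩
            rcases Finset.mem_insert.mp ht with rfl | ht
            · exact absurd h (hneg δ hδ)
            · exact h1 t ht h
        · intro s hs
          rw [List.mem_cons, not_or]
          rcases Finset.mem_insert.mp hs with rfl | hs
          · exact ⟨hcγ, fun h => hcY' (tail.mem_of_mem _ h)⟩
          · exact ⟨hγl s (.inr hs), hSl s hs⟩
        · rw [Finset.coe_insert, Set.union_insert, hins]
          -- In a relation `c = a • γ + z`, the coefficient at the other end `d` forces `a = 0`.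
          -- Pairing with the coroot of `γ` then gives `1 = 0`.
          refine hli'.insert fun h => ?_
          rw [Set.image_insert_eq, Submodule.mem_span_insert] at h
          obtain ⟨a, z, hz, hcz⟩ := h
          have hdz : b.toWeightBasis.coord ⟨d, hd⟩ z = 0 := by
            clear hcz
            induction hz using Submodule.span_induction with
            | mem x hx =>
              obtain ⟨t, ht, rfl⟩ := hx
              obtain ⟨htY, ht0⟩ := hT t ht
              rw [toWeightBasis_coord_root]
              by_contra h0
              have := (b.coeff_mem_of_isFace hf' htY ht0 hd (by exact_mod_cast h0)).2
              omega
            | zero => simp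
            | add x y _ _ hx hy => rw [map_add, hx, hy, add_zero]
            | smul a x _ hx => rw [map_smul, hx, smul_zero]
          have h1 := congrArg (b.toWeightBasis.coord ⟨d, hd⟩) hcz
          rw [map_add, map_smul, hdz, toWeightBasis_coord_root, toWeightBasis_coord_root,
            b.coeff_of_mem_support hc hd, if_neg hcd.symm, hd1] at h1
          have ha : a = 0 := by simpa using h1.symm
          have h2 := congrArg (fun x => P.toLinearMap x (P.coroot γ)) hcz
          simp only [ha, zero_smul, zero_add, hker z hz] at h2
          rw [root_coroot_eq_pairing, ← P.algebraMap_pairingIn ℤ, hc2, map_one] at h2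
          exact one_ne_zero h2
        · rw [hsplit, he, ← hcard, List.length_cons, Finset.card_insert_of_notMem hcS',
            Finset.card_pair hcd]
          omega
      by_cases hcS : ∀ α ∈ S, P.pairingIn ℤ α c = 0
      · exact key c d hcd he hc1 hc2 hd1 hd2 hcS
      · push Not at hcS
        obtain ⟨α, hα, hαc⟩ := hcS
        refine key d c hcd.symm (by rw [he, Finset.pair_comm]) hd1 hd2 hc1 hc2 fun β hβ => ?_
        by_contra hβd
        obtain ⟨hc, hcY, -⟩ := mem_ends.mp (show c ∈ b.ends Y γ by simp [he])
        obtain ⟨hd, hdY, -⟩ := mem_ends.mp (show d ∈ b.ends Y γ by simp [he])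
        exact false_of_adjacent hY hf mem pos max tail hS hSY hsp hcd hc hd hcY hdY hc2 hd2 hα hβ
          hαc hβd

end Base

end RootPairing

/-! ### Root coordinates and iterated radicals along a cascade. -/

namespace LieIndex

open Module RootPairing

variable {ι k M N L : Type*} [Fintype ι] [Field k] [CharZero k] [AddCommGroup M] [Module k M]
  [AddCommGroup N] [Module k N] [LieRing L] [LieAlgebra k L]

/-- Coordinates on a Lie algebra adapted to a root decomposition, with an invariant form. -/
structure RootCoordinates (P : RootPairing ι k M N) (L : Type*) [LieRing L] [LieAlgebra k L] where
  cartan : N →ₗ[k] L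
  proj : L →ₗ[k] N
  vec : ι → L
  coord : ι → Dual k L
  form : LinearMap.BilinForm k L
  expand : ∀ x, cartan (proj x) + ∑ i, coord i x • vec i = x
  proj_cartan : ∀ h, proj (cartan h) = h
  proj_vec : ∀ i, proj (vec i) = 0
  coord_cartan : ∀ i h, coord i (cartan h) = 0
  coord_vec_self : ∀ i, coord i (vec i) = 1
  coord_vec_of_ne : ∀ i j, i ≠ j → coord i (vec j) = 0
  lie_cartan_cartan : ∀ h h', ⁅cartan h, cartan h'⁆ = 0
  lie_cartan_vec : ∀ h i, ⁅cartan h, vec i⁆ = P.root' i h • vec i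
  coord_lie_vec : ∀ i j l, coord l ⁅vec i, vec j⁆ ≠ 0 ↔ P.root l = P.root i + P.root j
  lie_vec_vec : ∀ i j, P.root i + P.root j ≠ 0 → (∀ l, P.root l ≠ P.root i + P.root j) →
    ⁅vec i, vec j⁆ = 0
  form_symm : ∀ x y, form x y = form y x
  form_lie : ∀ x y z, form ⁅x, y⁆ z = form x ⁅y, z⁆
  form_cartan_vec : ∀ h i, form (cartan h) (vec i) = 0
  form_vec_vec : ∀ i j, form (vec i) (vec j) ≠ 0 ↔ P.root i + P.root j = 0
  form_cartan_coroot : ∀ h i, P.root' i h = 0 → form (cartan h) (cartan (P.coroot i)) = 0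
  form_cartan_nondegenerate : ∀ h, (∀ h', form (cartan h) (cartan h') = 0) → h = 0

namespace RootCoordinates

variable {P : RootPairing ι k M N} (c : RootCoordinates P L)

theorem coord_lie_cartan (γ : ι) (h : N) (y : L) :
    c.coord γ ⁅c.cartan h, y⁆ = P.root' γ h * c.coord γ y := by
  classical
  conv_lhs => rw [← c.expand y]
  rw [lie_add, c.lie_cartan_cartan, zero_add, lie_sum, map_sum, Finset.sum_eq_single γ]
  · rw [lie_smul, c.lie_cartan_vec, map_smul, map_smul, c.coord_vec_self]
    simp [mul_comm]
  · intro i _ hi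
    rw [lie_smul, c.lie_cartan_vec, map_smul, map_smul, c.coord_vec_of_ne γ i hi.symm]
    simp
  · simp

theorem coord_lie (γ : ι) (x y : L) :
    c.coord γ ⁅x, y⁆ = P.root' γ (c.proj x) * c.coord γ y - P.root' γ (c.proj y) * c.coord γ x +
      ∑ i, ∑ j, c.coord i x * (c.coord j y * c.coord γ ⁅c.vec i, c.vec j⁆) := by
  have h1 : ∀ i, c.coord γ ⁅c.vec i, y⁆ = -(P.root' γ (c.proj y) * c.coord γ (c.vec i)) +
      ∑ j, c.coord j y * c.coord γ ⁅c.vec i, c.vec j⁆ := by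
    intro i
    conv_lhs => rw [← c.expand y]
    rw [lie_add, map_add, ← lie_skew, map_neg, c.coord_lie_cartan, lie_sum, map_sum]
    simp only [lie_smul, map_smul, smul_eq_mul]
  have h2 : ∑ i, c.coord i x * c.coord γ (c.vec i) = c.coord γ x := by
    conv_rhs => rw [← c.expand x]
    rw [map_add, c.coord_cartan, zero_add, map_sum]
    simp only [map_smul, smul_eq_mul]
  conv_lhs => rw [← c.expand x]
  rw [add_lie, map_add, c.coord_lie_cartan, sum_lie, map_sum]
  simp only [smul_lie, map_smul, smul_eq_mul, h1, mul_add, Finset.sum_add_distrib, Finset.mul_sum]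
  rw [← h2, Finset.mul_sum, sub_eq_add_neg, ← Finset.sum_neg_distrib, ← add_assoc]
  congr 2
  refine Finset.sum_congr rfl fun i _ => by ring

/-- The subspace of vectors whose Cartan part is killed by the roots in `D` and whose root
components are supported in `A`. -/
def subspace (D A : Set ι) : Submodule k L where
  carrier := {x | (∀ γ ∈ D, P.root' γ (c.proj x) = 0) ∧ ∀ α, α ∉ A → c.coord α x = 0}
  add_mem' hx hy := ⟨fun γ hγ => by rw [map_add, map_add, hx.1 γ hγ, hy.1 γ hγ, add_zero],
    fun α hα => by rw [map_add, hx.2 α hα, hy.2 α hα, add_zero]⟩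
  zero_mem' := ⟨fun γ _ => by simp, fun α _ => by simp⟩
  smul_mem' a x hx := ⟨fun γ hγ => by rw [map_smul, map_smul, hx.1 γ hγ, smul_zero],
    fun α hα => by rw [map_smul, hx.2 α hα, smul_zero]⟩

variable {c} {D A : Set ι}

theorem vec_mem_subspace {α : ι} (hα : α ∈ A) : c.vec α ∈ c.subspace D A :=
  ⟨fun γ _ => by rw [c.proj_vec, map_zero], fun β hβ => c.coord_vec_of_ne β α (by
    rintro rfl
    exact hβ hα)⟩

theorem cartan_mem_subspace {h : N} (hh : ∀ γ ∈ D, P.root' γ h = 0) :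
    c.cartan h ∈ c.subspace D A :=
  ⟨fun γ hγ => by rw [c.proj_cartan, hh γ hγ], fun α _ => c.coord_cartan α h⟩

theorem coord_lie_eq_zero_of_ne {i j l : ι} (h : P.root l ≠ P.root i + P.root j) :
    c.coord l ⁅c.vec i, c.vec j⁆ = 0 :=
  not_ne_iff.mp fun h' => h ((c.coord_lie_vec i j l).mp h')

theorem coord_lie_vec_right (γ j : ι) (x : L) :
    c.coord γ ⁅x, c.vec j⁆ = P.root' γ (c.proj x) * c.coord γ (c.vec j) +
      ∑ i, c.coord i x * c.coord γ ⁅c.vec i, c.vec j⁆ := by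
  rw [c.coord_lie, c.proj_vec, map_zero, zero_mul, sub_zero]
  congr 1
  refine Finset.sum_congr rfl fun i _ => ?_
  rw [Finset.sum_eq_single j, c.coord_vec_self, one_mul]
  · intro l _ hl
    rw [c.coord_vec_of_ne l j hl, zero_mul, mul_zero]
  · simp

/-- Under the form of the `γ`-th coordinate, root vectors pair when their roots sum to `γ`, and the
vector of `γ` pairs with the Cartan part. `C` marks the case in which `γ` already vanishes on that
part, so that its vector stays in the radical. -/
theorem radical_subspace {γ : ι} (hγ : γ ∈ A) {C : Set ι}
    (hC : γ ∈ C → ∀ h, (∀ δ ∈ D, P.root' δ h = 0) → P.root' γ h = 0)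
    (hC' : γ ∉ C → ∃ h, (∀ δ ∈ D, P.root' δ h = 0) ∧ P.root' γ h ≠ 0) :
    radical (coadjointForm (c.coord γ)) (c.subspace D A) = c.subspace (insert γ D)
      {β | β ∈ A ∧ (β = γ → γ ∈ C) ∧ ∀ β' ∈ A, P.root γ ≠ P.root β + P.root β'} := by
  ext x
  constructor
  · rintro ⟨hxV, hx⟩
    have hx0 : P.root' γ (c.proj x) = 0 := by
      have := hx _ (vec_mem_subspace hγ)
      rw [coadjointForm_apply, coord_lie_vec_right, c.coord_vec_self, mul_one,
        Finset.sum_eq_zero, add_zero] at this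
      · exact this
      · intro i _
        rw [coord_lie_eq_zero_of_ne, mul_zero]
        intro h
        exact P.ne_zero i (by simpa using h)
    refine ⟨fun δ hδ => ?_, fun α hα => ?_⟩
    · rcases Set.mem_insert_iff.mp hδ with rfl | hδ
      · exact hx0
      · exact hxV.1 δ hδ
    · by_contra h0
      refine hα ⟨by_contra fun hA => h0 (hxV.2 α hA), ?_, ?_⟩
      · rintro rfl
        by_contra hαC
        obtain ⟨h, hD, hne⟩ := hC' hαC
        have := hx _ (cartan_mem_subspace hD)
        rw [coadjointForm_apply, ← lie_skew, map_neg, c.coord_lie_cartan, neg_eq_zero] at this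
        exact mul_ne_zero hne h0 this
      · intro β' hβ' hsum
        have := hx _ (vec_mem_subspace hβ')
        rw [coadjointForm_apply, coord_lie_vec_right, hx0, zero_mul, zero_add,
          Finset.sum_eq_single α] at this
        · exact mul_ne_zero h0 ((c.coord_lie_vec _ _ _).mpr hsum) this
        · intro i _ hi
          rw [coord_lie_eq_zero_of_ne, mul_zero]
          intro h
          exact hi (P.root.injective (add_right_cancel (h.symm.trans hsum)))
        · simp
  · rintro ⟨hxD, hxA⟩
    have hxV : x ∈ c.subspace D A := ⟨fun δ hδ => hxD δ (Set.mem_insert_of_mem _ hδ),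
      fun α hα => hxA α fun h => hα h.1⟩
    refine ⟨hxV, fun y hy => ?_⟩
    have h2 : P.root' γ (c.proj y) * c.coord γ x = 0 := by
      by_cases hγC : γ ∈ C
      · rw [hC hγC _ hy.1, zero_mul]
      · rw [hxA γ fun h => hγC (h.2.1 rfl), mul_zero]
    rw [coadjointForm_apply, c.coord_lie, hxD γ (Set.mem_insert _ _), zero_mul, h2, sub_zero,
      zero_add]
    refine Finset.sum_eq_zero fun i _ => Finset.sum_eq_zero fun j _ => ?_
    by_cases hi : c.coord i x = 0
    · rw [hi, zero_mul]
    by_cases hj : c.coord j y = 0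
    · rw [hj, zero_mul, mul_zero]
    rw [coord_lie_eq_zero_of_ne, mul_zero, mul_zero]
    exact (by_contra fun h => hi (hxA i h) : i ∈ _).2.2 j (by_contra fun h => hj (hy.2 j h))

variable [P.IsCrystallographic] {ht : ι → ℤ} {Y : Set ι} {l : List ι}

/-- Each `γ` removes the roots of `Y` that are positive summands of it, leaving the positive roots
orthogonal to it. Roots in `B` are never such partners: negative ones would need a partner higher
than `γ`, and the members of `C` kept so far are strongly orthogonal to what remains. -/
theorem foldl_radical (hl : P.IsCascade ht Y l) (hY : P.IsClosedSubsystem Y) (h : P.IsHeight ht)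
    (D B C : Set ι)
    (hB : ∀ β ∈ B, ht β < 0 ∨ (β ∉ Y ∧ ∀ α ∈ Y, ∀ i, P.root i ≠ P.root α - P.root β))
    (hC : ∀ γ ∈ l, γ ∈ C → ∀ h, (∀ δ ∈ D, P.root' δ h = 0) → P.root' γ h = 0)
    (hC' : ∀ γ ∈ l, γ ∉ C → ∃ h, (∀ δ ∈ D, P.root' δ h = 0) ∧
      (∀ δ ∈ l, δ ≠ γ → P.root' δ h = 0) ∧ P.root' γ h ≠ 0) :
    l.foldl (fun W i => radical (coadjointForm (c.coord i)) W)
        (c.subspace D ({α | α ∈ Y ∧ 0 < ht α} ∪ B)) =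
      c.subspace (D ∪ {γ | γ ∈ l}) (B ∪ {γ | γ ∈ l ∧ γ ∈ C}) := by
  induction hl generalizing D B with
  | @nil Y h0 =>
    have : {α | α ∈ Y ∧ 0 < ht α} = ∅ := by
      ext α
      simp only [Set.mem_ofPred_eq, Set.mem_empty_iff_false, iff_false, not_and, not_lt]
      exact h0 α
    simp [this]
  | @cons Y γ l mem pos max tail ih =>
    have hnd : ∀ δ ∈ l, δ ≠ γ := by
      rintro δ hδ rfl
      have := (tail.mem_of_mem δ hδ).2
      rw [pairingIn_same] at this
      omega
    have noPartner : ∀ β ∈ {α | α ∈ Y ∧ 0 < ht α} ∪ B, ∀ β' ∈ B,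
        P.root γ ≠ P.root β + P.root β' := by
      intro β hβ β' hβ' hsum
      rcases hB β' hβ' with hneg | ⟨-, hno⟩
      · rcases hβ with ⟨hβY, -⟩ | hβ
        · have := max β hβY
          have := h.add hsum
          omega
        · rcases hB β hβ with hneg' | ⟨-, hno⟩
          · have := h.add hsum
            omega
          · exact hno γ mem β' (by rw [hsum]; abel)
      · exact hno γ mem β (by rw [hsum]; abel)
    have hγA : γ ∈ {α | α ∈ Y ∧ 0 < ht α} ∪ B := .inl ⟨mem, pos⟩
    rw [List.foldl_cons, radical_subspace hγA (C := C)
      (hC γ List.mem_cons_self) fun hγC => by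
        obtain ⟨h, hD, -, hne⟩ := hC' γ List.mem_cons_self hγC
        exact ⟨h, hD, hne⟩]
    have hset : {β | β ∈ {α | α ∈ Y ∧ 0 < ht α} ∪ B ∧ (β = γ → γ ∈ C) ∧
        ∀ β' ∈ {α | α ∈ Y ∧ 0 < ht α} ∪ B, P.root γ ≠ P.root β + P.root β'} =
        {α | α ∈ P.orthogonalIn Y γ ∧ 0 < ht α} ∪ (B ∪ {β | β = γ ∧ γ ∈ C}) := by
      ext β
      constructor
      · rintro ⟨hβ | hβ, hβC, hno⟩
        · by_cases hβγ : β = γ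
          · exact .inr (.inr ⟨hβγ, hβC hβγ⟩)
          · refine .inl ⟨⟨hβ.1, ?_⟩, hβ.2⟩
            by_contra h0
            obtain ⟨β', hβ', hβ'0, hsum⟩ :=
              (hY.pairingIn_ne_zero_iff h mem pos max hβ.1 hβ.2 hβγ).mp h0
            exact hno β' (.inl ⟨hβ', hβ'0⟩) hsum
        · exact .inr (.inl hβ)
      · rintro (⟨⟨hβY, hβ0⟩, hpos⟩ | hβ | ⟨rfl, hβC⟩)
        · have hβγ : β ≠ γ := by
            rintro rfl
            rw [pairingIn_same] at hβ0
            omega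
          refine ⟨.inl ⟨hβY, hpos⟩, fun h => absurd h hβγ, ?_⟩
          rintro β' (hβ' | hβ') hsum
          · exact (hY.pairingIn_ne_zero_iff h mem pos max hβY hpos hβγ).mpr
              ⟨β', hβ'.1, hβ'.2, hsum⟩ hβ0
          · exact noPartner β (.inl ⟨hβY, hpos⟩) β' hβ' hsum
        · refine ⟨.inr hβ, ?_, fun β' hβ' hsum => noPartner β' hβ' β hβ (by rw [hsum, add_comm])⟩
          rintro rfl
          rcases hB β hβ with hneg | ⟨hnot, -⟩
          · omega
          · exact absurd mem hnot
        · refine ⟨.inl ⟨mem, pos⟩, fun _ => hβC, fun β' _ hsum => ?_⟩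
          exact P.ne_zero β' (by simpa using hsum)
    rw [hset, ih (hY.orthogonalIn γ)]
    · congr 1
      · ext δ
        simp only [Set.mem_union, Set.mem_insert_iff, Set.mem_ofPred_eq, List.mem_cons]
        tauto
      · ext δ
        simp only [Set.mem_union, Set.mem_ofPred_eq, List.mem_cons]
        constructor
        · rintro ((h | ⟨rfl, h⟩) | ⟨h, h'⟩) <;> tauto
        · rintro (h | ⟨rfl | h, h'⟩) <;> tauto
    · rintro β (hβ | ⟨rfl, -⟩)
      · exact (hB β hβ).imp_right fun ⟨h1, h2⟩ => ⟨fun h => h1 h.1, fun α hα => h2 α hα.1⟩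
      · refine .inr ⟨fun h => ?_, fun α hα i => hY.sub_notMem_range h mem max hα.1 hα.2 i⟩
        have := h.2
        rw [pairingIn_same] at this
        omega
    · intro δ hδ hδC x hx
      exact hC δ (List.mem_cons_of_mem _ hδ) hδC x fun ε hε => hx ε (Set.mem_insert_of_mem _ hε)
    · intro δ hδ hδC
      obtain ⟨x, hxD, hxl, hne⟩ := hC' δ (List.mem_cons_of_mem _ hδ) hδC
      refine ⟨x, fun ε hε => ?_, fun ε hε => hxl ε (List.mem_cons_of_mem _ hε), hne⟩
      rcases Set.mem_insert_iff.mp hε with rfl | hε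
      · exact hxl _ List.mem_cons_self (hnd δ hδ).symm
      · exact hxD ε hε

end RootCoordinates

end LieIndex

/-! ### The exact kernel of the functional and its stability. -/

namespace LieIndex

open Module RootPairing

variable {ι k M N L : Type*} [Fintype ι] [Field k] [CharZero k] [AddCommGroup M] [Module k M]
  [AddCommGroup N] [Module k N] [LieRing L] [LieAlgebra k L]

/-- `C` consists of members of `s` whose negatives lie in `s`, strongly orthogonal to `s`. -/
structure IsPairedIn (P : RootPairing ι k M N) (s C : Finset ι) : Prop where
  mem : ∀ δ ∈ C, δ ∈ s
  neg_mem : ∀ δ ∈ C, P.reflectionPerm δ δ ∈ s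
  neg_notMem : ∀ δ ∈ C, P.reflectionPerm δ δ ∉ C
  sub_ne : ∀ δ ∈ C, ∀ γ ∈ s, ∀ m, P.root m ≠ P.root γ - P.root δ
  add_ne : ∀ δ ∈ C, ∀ γ ∈ s, ∀ m, P.root m ≠ P.root γ + P.root δ
  pairing_eq_zero : ∀ δ ∈ C, ∀ γ ∈ C, γ ≠ δ → P.pairing γ δ = 0

theorem root_reflectionPerm_self (P : RootPairing ι k M N) (i : ι) :
    P.root (P.reflectionPerm i i) = -P.root i := by
  rw [root_reflectionPerm, RootPairing.reflection_apply_self]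

theorem root'_reflectionPerm_self (P : RootPairing ι k M N) (i : ι) (h : N) :
    P.root' (P.reflectionPerm i i) h = -P.root' i h := by
  simp [root']

namespace RootCoordinates

variable {P : RootPairing ι k M N} {c : RootCoordinates P L} {s C : Finset ι} {a : ι → k}

variable (c s a) in
/-- A linear combination of coordinate functionals. -/
def functional : Dual k L := ∑ i ∈ s, a i • c.coord i

theorem functional_apply (x : L) : c.functional s a x = ∑ i ∈ s, a i * c.coord i x := by
  simp [functional]

theorem functional_vec {i : ι} (hi : i ∈ s) : c.functional s a (c.vec i) = a i := by
  rw [functional_apply, Finset.sum_eq_single i, c.coord_vec_self, mul_one]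
  · intro j _ hj
    rw [c.coord_vec_of_ne j i hj, mul_zero]
  · exact fun h => absurd hi h

theorem functional_lie_cartan {h : N} (hh : ∀ γ ∈ s, P.root' γ h = 0) (y : L) :
    c.functional s a ⁅c.cartan h, y⁆ = 0 := by
  rw [functional_apply]
  refine Finset.sum_eq_zero fun i hi => ?_
  rw [c.coord_lie_cartan, hh i hi, zero_mul, mul_zero]

theorem functional_lie_vec {i j : ι} (h : ∀ γ ∈ s, P.root j ≠ P.root γ - P.root i) :
    c.functional s a ⁅c.vec i, c.vec j⁆ = 0 := by
  rw [functional_apply]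
  refine Finset.sum_eq_zero fun γ hγ => ?_
  rw [coord_lie_eq_zero_of_ne, mul_zero]
  intro h'
  exact h γ hγ (by rw [h']; abel)

variable (c a) in
/-- The kernel vector of `functional` attached to a pair of opposite roots. -/
def pairVec (δ : ι) : L :=
  c.vec δ + (a δ / a (P.reflectionPerm δ δ)) • c.vec (P.reflectionPerm δ δ)

theorem lie_cartan_pairVec {h : N} {δ : ι} (hδ : P.root' δ h = 0) :
    ⁅c.cartan h, c.pairVec a δ⁆ = 0 := by
  rw [pairVec, lie_add, lie_smul, c.lie_cartan_vec, c.lie_cartan_vec, root'_reflectionPerm_self,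
    hδ]
  simp

/-- Against the Cartan part, the ratio in `pairVec` cancels the contributions of the two opposite
roots. Against root vectors, strong orthogonality leaves no term supported on `s`. -/
theorem functional_lie_pairVec (hs : IsPairedIn P s C) (ha : ∀ i, a i ≠ 0) {δ : ι} (hδ : δ ∈ C)
    (y : L) : c.functional s a ⁅c.pairVec a δ, y⁆ = 0 := by
  rw [← c.expand y, lie_add, lie_sum, map_add, map_sum, Finset.sum_eq_zero, add_zero]
  · rw [← lie_skew, map_neg, pairVec, lie_add, lie_smul, c.lie_cartan_vec, c.lie_cartan_vec,
      root'_reflectionPerm_self, map_add, map_smul, map_smul, map_smul,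
      functional_vec (hs.mem δ hδ), functional_vec (hs.neg_mem δ hδ)]
    have := ha (P.reflectionPerm δ δ)
    simp only [smul_eq_mul]
    field_simp
    ring
  · intro j _
    rw [lie_smul, pairVec, add_lie, smul_lie, map_smul, map_add, map_smul,
      functional_lie_vec fun γ hγ => hs.sub_ne δ hδ γ hγ j, functional_lie_vec fun γ hγ => ?_]
    · simp
    · rw [root_reflectionPerm_self, sub_neg_eq_add]
      exact hs.add_ne δ hδ γ hγ j

variable (P c C a) in
/-- Adds to a vector its components on the opposite roots, so that components in `C` become
multiples of `pairVec`. -/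
def twist : L →ₗ[k] L :=
  LinearMap.id + ∑ δ ∈ C, (a δ / a (P.reflectionPerm δ δ)) •
    (c.coord δ).smulRight (c.vec (P.reflectionPerm δ δ))

theorem twist_apply (x : L) : twist P c C a x =
    x + ∑ δ ∈ C, (a δ / a (P.reflectionPerm δ δ)) • c.coord δ x • c.vec (P.reflectionPerm δ δ) := by
  simp [twist, LinearMap.sum_apply]

theorem twist_injective (hC : ∀ δ ∈ C, P.reflectionPerm δ δ ∉ C) :
    Function.Injective (twist P c C a) := by
  rw [injective_iff_map_eq_zero]
  intro x hx
  have h : ∀ δ ∈ C, c.coord δ x = 0 := by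
    intro δ hδ
    have := congrArg (c.coord δ) hx
    rw [twist_apply, map_add, map_sum, Finset.sum_eq_zero, add_zero, map_zero] at this
    · exact this
    · intro ε hε
      rw [map_smul, map_smul, c.coord_vec_of_ne, smul_zero, smul_zero]
      rintro rfl
      exact hC ε hε hδ
  rw [twist_apply, Finset.sum_eq_zero, add_zero] at hx
  · exact hx
  · intro δ hδ
    rw [h δ hδ, zero_smul, smul_zero]

theorem expand_of_mem_subspace {D : Set ι} {x : L} (hx : x ∈ c.subspace D C) :
    x = c.cartan (c.proj x) + ∑ δ ∈ C, c.coord δ x • c.vec δ := by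
  conv_lhs => rw [← c.expand x]
  congr 1
  symm
  refine Finset.sum_subset (Finset.subset_univ C) fun i _ hi => ?_
  rw [hx.2 i (by simpa using hi), zero_smul]

theorem twist_eq {D : Set ι} {x : L} (hx : x ∈ c.subspace D C) :
    twist P c C a x = c.cartan (c.proj x) + ∑ δ ∈ C, c.coord δ x • c.pairVec a δ := by
  rw [twist_apply]
  conv_lhs => enter [1]; rw [expand_of_mem_subspace hx]
  rw [add_assoc, ← Finset.sum_add_distrib]
  congr 1
  refine Finset.sum_congr rfl fun δ _ => ?_
  rw [pairVec, smul_add, smul_comm (c.coord δ x)]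

theorem functional_lie_twist (hs : IsPairedIn P s C) (ha : ∀ i, a i ≠ 0) {x : L}
    (hx : x ∈ c.subspace s C) (y : L) : c.functional s a ⁅twist P c C a x, y⁆ = 0 := by
  rw [twist_eq hx, add_lie, map_add, functional_lie_cartan fun γ hγ => hx.1 γ (by simpa using hγ),
    zero_add, sum_lie, map_sum]
  refine Finset.sum_eq_zero fun δ hδ => ?_
  rw [smul_lie, map_smul, functional_lie_pairVec hs ha hδ, smul_zero]

theorem _root_.LieIndex.IsPairedIn.add_ne_zero (hs : IsPairedIn P s C) {δ ε : ι} (hδ : δ ∈ C)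
    (hε : ε ∈ C) : P.root δ + P.root ε ≠ 0 := by
  intro h
  have : P.reflectionPerm δ δ = ε := P.root.injective (by
    rw [root_reflectionPerm_self, ← eq_neg_of_add_eq_zero_right h])
  exact hs.neg_notMem δ hδ (this ▸ hε)

theorem lie_pairVec_pairVec (hs : IsPairedIn P s C) {δ ε : ι} (hδ : δ ∈ C) (hε : ε ∈ C) :
    ⁅c.pairVec a δ, c.pairVec a ε⁆ = 0 := by
  by_cases hne : ε = δ
  · rw [hne, lie_self]
  have hne' : P.root δ - P.root ε ≠ 0 := fun h => hne (P.root.injective (sub_eq_zero.mp h)).symm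
  have h0 := hs.add_ne_zero hδ hε
  have hadd := hs.add_ne ε hε δ (hs.mem δ hδ)
  have hsub := hs.sub_ne ε hε δ (hs.mem δ hδ)
  have hneg : ∀ v : M, (∀ m, P.root m ≠ v) → ∀ m, P.root m ≠ -v := by
    intro v hv m hm
    exact hv (P.reflectionPerm m m) (by rw [root_reflectionPerm_self, hm, neg_neg])
  rw [pairVec, pairVec, add_lie, lie_add, lie_add, smul_lie, smul_lie, lie_smul, lie_smul,
    c.lie_vec_vec δ ε h0 hadd, c.lie_vec_vec δ, c.lie_vec_vec _ ε, c.lie_vec_vec]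
  · simp
  all_goals simp only [root_reflectionPerm_self]
  · rw [← neg_add]
    exact neg_ne_zero.mpr h0
  · rw [← neg_add]
    exact hneg _ hadd
  · rw [neg_add_eq_sub, ← neg_sub]
    exact neg_ne_zero.mpr hne'
  · rw [neg_add_eq_sub, ← neg_sub]
    exact hneg _ hsub
  · rwa [← sub_eq_add_neg]
  · simpa only [← sub_eq_add_neg] using hsub

theorem form_pairVec_cartan (h : N) (δ : ι) : c.form (c.pairVec a δ) (c.cartan h) = 0 := by
  rw [c.form_symm, pairVec, map_add, map_smul, c.form_cartan_vec, c.form_cartan_vec]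
  simp

theorem form_vec_vec_eq_zero {i j : ι} (h : P.root i + P.root j ≠ 0) :
    c.form (c.vec i) (c.vec j) = 0 := not_ne_iff.mp fun h' => h ((c.form_vec_vec i j).mp h')

theorem form_pairVec_pairVec_of_ne (hs : IsPairedIn P s C) {δ ε : ι} (hδ : δ ∈ C) (hε : ε ∈ C)
    (hne : ε ≠ δ) : c.form (c.pairVec a δ) (c.pairVec a ε) = 0 := by
  have hne' : P.root δ - P.root ε ≠ 0 := fun h => hne (P.root.injective (sub_eq_zero.mp h)).symm
  have h0 := hs.add_ne_zero hδ hε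
  simp only [pairVec, map_add, map_smul, LinearMap.add_apply, LinearMap.smul_apply]
  rw [form_vec_vec_eq_zero h0, form_vec_vec_eq_zero, form_vec_vec_eq_zero, form_vec_vec_eq_zero]
  · simp
  all_goals simp only [root_reflectionPerm_self]
  · rw [← neg_add]
    exact neg_ne_zero.mpr h0
  · rwa [← sub_eq_add_neg]
  · rw [neg_add_eq_sub, ← neg_sub]
    exact neg_ne_zero.mpr hne'

theorem form_pairVec_self (ha : ∀ i, a i ≠ 0) (δ : ι) :
    c.form (c.pairVec a δ) (c.pairVec a δ) ≠ 0 := by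
  have h2 : ∀ i, P.root i + P.root i ≠ 0 := fun i h => P.ne_zero i (by
    rw [← two_smul k] at h
    exact (smul_eq_zero.mp h).resolve_left two_ne_zero)
  simp only [pairVec, map_add, map_smul, LinearMap.add_apply, LinearMap.smul_apply, smul_eq_mul]
  rw [form_vec_vec_eq_zero (h2 δ), form_vec_vec_eq_zero (h2 _), zero_add, mul_zero, add_zero,
    c.form_symm (c.vec (P.reflectionPerm δ δ)), ← two_mul]
  refine mul_ne_zero two_ne_zero (mul_ne_zero (div_ne_zero (ha _) (ha _)) ?_)
  rw [c.form_vec_vec, root_reflectionPerm_self, add_neg_cancel]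

theorem lie_twist_eq_zero {x w : L} {D : Set ι} (hx : x ∈ c.subspace D C)
    (h1 : ⁅w, c.cartan (c.proj x)⁆ = 0) (h2 : ∀ δ ∈ C, ⁅w, c.pairVec a δ⁆ = 0) :
    ⁅w, twist P c C a x⁆ = 0 := by
  rw [twist_eq hx, lie_add, h1, zero_add, lie_sum]
  exact Finset.sum_eq_zero fun δ hδ => by rw [lie_smul, h2 δ hδ, smul_zero]

/-- By invariance of the form, everything that commutes with this subspace `K` is orthogonal to `⁅K,
L⁆`. Since `K` is commutative, the vectors `pairVec` qualify and kill the components along `C`;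
Cartan elements killed by `C` then deal with what is left. -/
theorem disjoint_span_lie_twist (hs : IsPairedIn P s C) (ha : ∀ i, a i ≠ 0) :
    Disjoint ((c.subspace s C).map (twist P c C a)) (Submodule.span k
      {z | ∃ x ∈ (c.subspace s C).map (twist P c C a), ∃ y, ⁅x, y⁆ = z}) := by
  rw [Submodule.disjoint_def]
  rintro _ ⟨x, hx, rfl⟩ hz
  have key : ∀ w, (∀ x ∈ c.subspace s C, ⁅w, twist P c C a x⁆ = 0) →
      c.form w (twist P c C a x) = 0 := by
    intro w hw
    generalize twist P c C a x = z at hz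
    induction hz using Submodule.span_induction with
    | mem z hz =>
      obtain ⟨_, ⟨v, hv, rfl⟩, y, rfl⟩ := hz
      rw [← c.form_lie, hw v hv, map_zero, LinearMap.zero_apply]
    | zero => exact map_zero _
    | add z z' _ _ h h' => rw [map_add, h, h', add_zero]
    | smul r z _ h => rw [map_smul, h, smul_zero]
  have hCs : ∀ x ∈ c.subspace s C, ∀ δ ∈ C, P.root' δ (c.proj x) = 0 :=
    fun x hx δ hδ => hx.1 δ (by simpa using hs.mem δ hδ)
  have h1 : ∀ δ ∈ C, c.coord δ x = 0 := by
    intro δ hδ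
    have := key (c.pairVec a δ) fun v hv => lie_twist_eq_zero hv
      (by rw [← lie_skew, lie_cartan_pairVec (hCs v hv δ hδ), neg_zero])
      fun ε hε => lie_pairVec_pairVec hs hδ hε
    rw [twist_eq hx, map_add, form_pairVec_cartan, zero_add, map_sum,
      Finset.sum_eq_single_of_mem δ hδ, map_smul] at this
    · exact (smul_eq_zero.mp this).resolve_right (form_pairVec_self ha δ)
    · intro ε hε hne
      rw [map_smul, form_pairVec_pairVec_of_ne hs hδ hε hne, smul_zero]
  have h2 : twist P c C a x = c.cartan (c.proj x) := by
    rw [twist_eq hx, Finset.sum_eq_zero, add_zero]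
    exact fun δ hδ => by rw [h1 δ hδ, zero_smul]
  rw [h2]
  rw [h2] at key
  rw [c.form_cartan_nondegenerate (c.proj x), map_zero]
  intro h
  -- Removing the coroot components makes `h'` commute with every `pairVec`. The form does not
  -- notice, because the roots of `C` vanish on the Cartan part of `x`.
  set h' := h - ∑ δ ∈ C, (P.root' δ h / 2) • P.coroot δ with hh'
  have h3 : ∀ δ ∈ C, P.root' δ h' = 0 := by
    intro δ hδ
    rw [hh', map_sub, map_sum, Finset.sum_eq_single_of_mem δ hδ, map_smul, root'_coroot_eq_pairing,
      pairing_same]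
    · simp
    · intro ε hε hne
      rw [map_smul, root'_coroot_eq_pairing, hs.pairing_eq_zero ε hε δ hδ hne.symm, smul_zero]
  have h4 := key (c.cartan h') fun v hv => lie_twist_eq_zero hv (c.lie_cartan_cartan _ _)
    fun ε hε => lie_cartan_pairVec (h3 ε hε)
  rw [c.form_symm, hh', map_sub, map_sub, map_sum, map_sum, Finset.sum_eq_zero, sub_zero] at h4
  · exact h4
  · intro δ hδ
    rw [map_smul, map_smul, c.form_cartan_coroot _ _ (hCs x hx δ hδ), smul_zero]

end RootCoordinates

end LieIndex

/-! ### The index of a parabolic subalgebra in terms of two cascades. -/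

namespace LieIndex

open Module RootPairing

variable {ι k M N L : Type*} [Fintype ι] [DecidableEq ι] [Field k] [CharZero k]
  [AddCommGroup M] [Module k M]
  [AddCommGroup N] [Module k N] [LieRing L] [LieAlgebra k L] [FiniteDimensional k L]

theorem map_subtype_ker_coadjointForm (p : LieSubalgebra k L) (f : Dual k L) :
    (LinearMap.ker (coadjointForm (f ∘ₗ (p.incl : p →ₗ[k] L)))).map (p.incl : p →ₗ[k] L) = radical (coadjointForm f) p.toSubmodule := by
  ext x
  constructor
  · rintro ⟨y, hy, rfl⟩
    exact ⟨y.2, fun z hz => mem_ker_coadjointForm.mp hy ⟨z, hz⟩⟩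
  · rintro ⟨hx, h⟩
    exact ⟨⟨x, hx⟩, mem_ker_coadjointForm.mpr fun y => h y y.2, rfl⟩

theorem index_eq_finrank_radical (p : LieSubalgebra k L) (f : Dual k L)
    (h : Disjoint (radical (coadjointForm f) p.toSubmodule) (Submodule.span k
      {z | ∃ x ∈ radical (coadjointForm f) p.toSubmodule, ∃ y, ⁅x, y⁆ = z})) :
    index k p = finrank k (radical (coadjointForm f) p.toSubmodule) := by
  have hinj : Function.Injective (p.incl : p →ₗ[k] L) := Subtype.val_injective
  rw [← map_subtype_ker_coadjointForm] at h ⊢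
  rw [index_eq_finrank_ker (f ∘ₗ (p.incl : p →ₗ[k] L))]
  · exact (Submodule.equivMapOfInjective _ hinj _).finrank_eq
  · rw [Submodule.disjoint_def] at h ⊢
    intro z hz hz'
    refine hinj ((h _ (Submodule.mem_map_of_mem hz) ?_).trans (map_zero _).symm)
    have := Submodule.mem_map_of_mem (f := (p.incl : p →ₗ[k] L)) hz'
    rw [Submodule.map_span] at this
    refine Submodule.span_mono ?_ this
    rintro _ ⟨_, ⟨x, hx, y, rfl⟩, rfl⟩
    exact ⟨x, Submodule.mem_map_of_mem hx, y, rfl⟩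

namespace RootCoordinates

variable {P : RootPairing ι k M N} {c : RootCoordinates P L} {s C : Finset ι} {a : ι → k}

/-- The twisted vectors lie in the radical, and the dimension bound `hrad` leaves no room for
others. -/
theorem radical_eq_map_twist (hs : IsPairedIn P s C) (ha : ∀ i, a i ≠ 0) {p : Submodule k L}
    (hp : c.subspace s C ≤ p) (hneg : ∀ δ ∈ C, c.vec (P.reflectionPerm δ δ) ∈ p)
    (hrad : finrank k (radical (coadjointForm (c.functional s a)) p) ≤
      finrank k (c.subspace s C)) :
    (c.subspace s C).map (twist P c C a) = radical (coadjointForm (c.functional s a)) p := by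
  refine Submodule.eq_of_le_of_finrank_le ?_ (hrad.trans
    (Submodule.equivMapOfInjective _ (twist_injective hs.neg_notMem) _).finrank_eq.le)
  rintro _ ⟨x, hx, rfl⟩
  refine ⟨?_, fun y _ => functional_lie_twist hs ha hx y⟩
  rw [twist_apply]
  exact add_mem (hp hx) (sum_mem fun δ hδ => p.smul_mem _ (p.smul_mem _ (hneg δ hδ)))

theorem index_eq_finrank_subspace (hs : IsPairedIn P s C) (ha : ∀ i, a i ≠ 0)
    {p : LieSubalgebra k L} (hp : c.subspace s C ≤ p.toSubmodule)
    (hneg : ∀ δ ∈ C, c.vec (P.reflectionPerm δ δ) ∈ p.toSubmodule)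
    (hrad : finrank k (radical (coadjointForm (c.functional s a)) p.toSubmodule) ≤
      finrank k (c.subspace s C)) :
    index k p = finrank k (c.subspace s C) := by
  have h := radical_eq_map_twist hs ha hp hneg hrad
  rw [index_eq_finrank_radical p (c.functional s a) (h ▸ disjoint_span_lie_twist hs ha), ← h]
  exact (Submodule.equivMapOfInjective _ (twist_injective hs.neg_notMem) _).finrank_eq.symm

theorem sum_smul_coadjointForm {l : List ι} (hl : l.Nodup) :
    (l.map fun i => a i • coadjointForm (c.coord i)).sum =
      coadjointForm (c.functional l.toFinset a) := by
  ext x y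
  rw [← List.sum_toFinset _ hl, LinearMap.sum_apply, LinearMap.sum_apply, coadjointForm_apply,
    functional_apply]
  rfl

/-- The common kernel of the roots in `D`. -/
def commonKer (P : RootPairing ι k M N) (D : Set ι) : Submodule k N :=
  ⨅ γ ∈ D, LinearMap.ker (P.root' γ)

theorem mem_commonKer {D : Set ι} {h : N} : h ∈ commonKer P D ↔ ∀ γ ∈ D, P.root' γ h = 0 := by
  simp [commonKer]

theorem finrank_commonKer_add [FiniteDimensional k N] {D : Finset ι}
    (hD : LinearIndepOn k P.root D) :
    finrank k (commonKer P D) + D.card = finrank k N := by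
  have hD' : LinearIndepOn k P.root' D :=
    hD.map_injOn P.toLinearMap (P.toPerfPair.injective.injOn)
  have h1 : commonKer P D = (Submodule.span k (P.root' '' D)).dualCoannihilator := by
    ext h
    rw [mem_commonKer, Submodule.mem_dualCoannihilator]
    refine ⟨fun hh φ hφ => ?_, fun hh γ hγ => hh _ (Submodule.subset_span ⟨γ, hγ, rfl⟩)⟩
    induction hφ using Submodule.span_induction with
    | mem φ hφ =>
      obtain ⟨γ, hγ, rfl⟩ := hφ
      exact hh γ hγ
    | zero => rfl
    | add φ ψ _ _ h1 h2 => rw [LinearMap.add_apply, h1, h2, add_zero]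
    | smul r φ _ h1 => rw [LinearMap.smul_apply, h1, smul_zero]
  have h2 := Subspace.finrank_add_finrank_dualCoannihilator_eq (Submodule.span k (P.root' '' D))
  have h3 : finrank k (Submodule.span k (P.root' '' D)) = D.card := by
    rw [Set.image_eq_range, finrank_span_eq_card hD']
    simp
  rw [h1]
  omega

/-- The coordinates of a vector of `subspace`. -/
def subspaceEquiv (c : RootCoordinates P L) (D : Set ι) (C : Finset ι) :
    c.subspace D C ≃ₗ[k] commonKer P D × (C → k) where
  toFun x := ⟨⟨c.proj x, mem_commonKer.mpr x.2.1⟩, fun δ => c.coord δ x⟩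
  map_add' x y := by
    ext <;> simp
  map_smul' r x := by
    ext <;> simp
  invFun y := ⟨c.cartan y.1 + ∑ δ : C, y.2 δ • c.vec δ,
    add_mem (cartan_mem_subspace (mem_commonKer.mp y.1.2))
      (sum_mem fun δ _ => Submodule.smul_mem _ _ (vec_mem_subspace δ.2))⟩
  left_inv x := by
    ext1
    conv_rhs => rw [expand_of_mem_subspace x.2]
    simp only
    rw [Finset.sum_coe_sort C fun δ => c.coord δ (x : L) • c.vec δ]
  right_inv y := by
    ext δ
    · simp [c.proj_cartan, c.proj_vec]
    · simp only [map_add, map_sum, map_smul, c.coord_cartan, zero_add]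
      rw [Finset.sum_eq_single δ, c.coord_vec_self, smul_eq_mul, mul_one]
      · intro ε _ hε
        rw [c.coord_vec_of_ne _ _ fun h => hε (Subtype.ext h.symm), smul_zero]
      · simp

theorem finrank_subspace [FiniteDimensional k N] (c : RootCoordinates P L) (D : Set ι)
    (C : Finset ι) : finrank k (c.subspace D C) = finrank k (commonKer P D) + C.card := by
  rw [(subspaceEquiv c D C).finrank_eq, finrank_prod, finrank_fintype_fun_eq_card,
    Fintype.card_coe]

variable [P.IsCrystallographic] [P.IsReduced] {ht : ι → ℤ} {Y : Set ι} {l₁ l₂ : List ι}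

theorem root_ne_add_self (i m : ι) : P.root m ≠ P.root i + P.root i := by
  have : IsAddTorsionFree M := .of_isTorsionFree k M
  exact fun h => P.nsmul_notMem_range_root (n := 2) (i := i) ⟨m, by rw [h, two_smul]⟩

/-- A member of `C` is, up to sign, in both cascades, so strong orthogonality inside each of them
applies to it. -/
theorem isPairedIn_cascades (h : P.IsHeight ht) (hY : P.IsClosedSubsystem Y)
    (hl₁ : P.IsCascade ht Set.univ l₁) (hl₂ : P.IsCascade (-ht) Y l₂)
    (hC : ∀ δ ∈ C, δ ∈ l₂ ∧ P.reflectionPerm δ δ ∈ l₁) :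
    IsPairedIn P (l₁ ++ l₂).toFinset C := by
  have so₁ := fun {γ δ} => hl₁.stronglyOrthogonal isClosedSubsystem_univ h (γ := γ) (δ := δ)
  have so₂ := fun {γ δ} => hl₂.stronglyOrthogonal hY h.neg_height (γ := γ) (δ := δ)
  refine ⟨fun δ hδ => ?_, fun δ hδ => ?_, fun δ hδ hδ' => ?_, fun δ hδ γ hγ m hm => ?_,
    fun δ hδ γ hγ m hm => ?_, fun δ hδ γ hγ hne => ?_⟩
  · simp [(hC δ hδ).1]
  · simp [(hC δ hδ).2]
  · have h1 := hl₁.pos_of_mem _ (hC δ hδ).2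
    have h2 := hl₂.pos_of_mem _ (hC _ hδ').1
    rw [Pi.neg_apply] at h2
    omega
  · obtain ⟨h2, h1⟩ := hC δ hδ
    rw [List.mem_toFinset, List.mem_append] at hγ
    rcases hγ with hγ | hγ
    · rw [sub_eq_add_neg, ← root_reflectionPerm_self] at hm
      by_cases he : γ = P.reflectionPerm δ δ
      · exact root_ne_add_self _ m (he ▸ hm)
      · exact ((so₁ hγ h1 he).2 m).1 hm
    · by_cases he : γ = δ
      · rw [he, sub_self] at hm
        exact P.ne_zero m hm
      · exact ((so₂ hγ h2 he).2 m).2 hm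
  · obtain ⟨h2, h1⟩ := hC δ hδ
    rw [List.mem_toFinset, List.mem_append] at hγ
    rcases hγ with hγ | hγ
    · rw [← sub_neg_eq_add, ← root_reflectionPerm_self] at hm
      by_cases he : γ = P.reflectionPerm δ δ
      · rw [he, sub_self] at hm
        exact P.ne_zero m hm
      · exact ((so₁ hγ h1 he).2 m).2 hm
    · by_cases he : γ = δ
      · exact root_ne_add_self _ m (he ▸ hm)
      · exact ((so₂ hγ h2 he).2 m).1 hm
  · rw [← P.algebraMap_pairingIn ℤ, (so₂ (hC γ hγ).1 (hC δ hδ).1 hne).1, map_zero]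

theorem foldl_radical_cascades (h : P.IsHeight ht) (hY : P.IsClosedSubsystem Y)
    (hl₁ : P.IsCascade ht Set.univ l₁) (hl₂ : P.IsCascade (-ht) Y l₂)
    (hC : ∀ δ ∈ C, δ ∈ l₂ ∧ P.reflectionPerm δ δ ∈ l₁)
    (hC' : ∀ γ ∈ l₂, γ ∉ C → ∃ h, (∀ δ ∈ l₁, P.root' δ h = 0) ∧
      (∀ δ ∈ l₂, δ ≠ γ → P.root' δ h = 0) ∧ P.root' γ h ≠ 0) :
    (l₁ ++ l₂).foldl (fun W i => radical (coadjointForm (c.coord i)) W)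
      (c.subspace ∅ ({α | 0 < ht α} ∪ {α | α ∈ Y ∧ ht α < 0})) =
        c.subspace (l₁ ++ l₂).toFinset C := by
  have e₁ := foldl_radical (c := c) hl₁ isClosedSubsystem_univ h ∅ {α | α ∈ Y ∧ ht α < 0} ∅
    -- In the first cascade nothing is kept: its members are orthogonal, so coroots separate them.
    (fun β hβ => .inl hβ.2) (fun γ _ hγ => hγ.elim) (fun γ hγ _ => ⟨P.coroot γ, by simp,
      fun δ hδ hne => by
        rw [root'_coroot_eq_pairing, ← P.algebraMap_pairingIn ℤ,
          (hl₁.stronglyOrthogonal isClosedSubsystem_univ h hδ hγ hne).1, map_zero],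
      by rw [root'_coroot_eq_pairing, pairing_same]; exact two_ne_zero⟩)
  have e₂ := foldl_radical (c := c) hl₂ hY h.neg_height {γ | γ ∈ l₁} ∅ C (fun β hβ => hβ.elim)
    (fun γ _ hγ x hx => by
      have := hx _ (hC γ hγ).2
      rwa [root'_reflectionPerm_self, neg_eq_zero] at this) hC'
  simp only [Set.mem_univ, true_and, Set.empty_union, Set.mem_empty_iff_false, and_false,
    Set.ofPred_false, Set.union_empty, Pi.neg_apply, Left.neg_pos_iff] at e₁ e₂
  rw [List.foldl_append, e₁, e₂]
  congr 1
  · ext γ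
    simp
  · ext γ
    simp only [Set.mem_ofPred_eq, SetLike.mem_coe, and_iff_right_iff_imp]
    exact fun hγ => (hC γ hγ).1

theorem index_eq_of_cascades (h : P.IsHeight ht) (hY : P.IsClosedSubsystem Y)
    (hl₁ : P.IsCascade ht Set.univ l₁) (hl₂ : P.IsCascade (-ht) Y l₂)
    (hC : ∀ δ ∈ C, δ ∈ l₂ ∧ P.reflectionPerm δ δ ∈ l₁)
    (hC' : ∀ γ ∈ l₂, γ ∉ C → ∃ h, (∀ δ ∈ l₁, P.root' δ h = 0) ∧
      (∀ δ ∈ l₂, δ ≠ γ → P.root' δ h = 0) ∧ P.root' γ h ≠ 0) {p : LieSubalgebra k L}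
    (hp : p.toSubmodule = c.subspace ∅ ({α | 0 < ht α} ∪ {α | α ∈ Y ∧ ht α < 0})) :
    index k p = finrank k (c.subspace (l₁ ++ l₂).toFinset C) := by
  have hnd : (l₁ ++ l₂).Nodup := hl₁.nodup.append hl₂.nodup fun γ h1 h2 => by
    have h1 := hl₁.pos_of_mem _ h1
    have h2 := hl₂.pos_of_mem _ h2
    rw [Pi.neg_apply] at h2
    omega
  obtain ⟨a, ha, hle⟩ := exists_finrank_radical_sum_le (fun i => coadjointForm (c.coord i))
    (fun i => coadjointForm_isAlt _) hnd p.toSubmodule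
  rw [sum_smul_coadjointForm hnd, hp, foldl_radical_cascades h hY hl₁ hl₂ hC hC', ← hp] at hle
  refine index_eq_finrank_subspace (isPairedIn_cascades h hY hl₁ hl₂ hC) ha ?_ ?_ hle
  · rw [hp]
    refine fun x hx => ⟨fun _ h => h.elim, fun α hα => hx.2 α fun hαC => hα (.inr ?_)⟩
    have hα := (hC α hαC).1
    have := hl₂.pos_of_mem _ hα
    exact ⟨hl₂.mem_of_mem _ hα, by simpa using this⟩
  · intro δ hδ
    rw [hp]
    exact vec_mem_subspace (.inl (hl₁.pos_of_mem _ (hC δ hδ).2))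

end RootCoordinates

end LieIndex

/-! ### The two choices of `Y`, giving every index up to the rank. -/

namespace LieIndex

namespace RootCoordinates

open Module RootPairing

variable {ι k M N L : Type*} [Fintype ι] [DecidableEq ι] [Field k] [CharZero k]
  [AddCommGroup M] [Module k M]
  [AddCommGroup N] [Module k N] [FiniteDimensional k N] [LieRing L] [LieAlgebra k L]
  [FiniteDimensional k L] {P : RootPairing ι k M N}

theorem exists_root'_ne_zero {D : Finset ι} (hD : LinearIndepOn k P.root D) {γ : ι} (hγ : γ ∈ D) :
    ∃ h, (∀ δ ∈ D, δ ≠ γ → P.root' δ h = 0) ∧ P.root' γ h ≠ 0 := by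
  by_contra! hno
  have h1 := finrank_commonKer_add hD
  have h2 := finrank_commonKer_add (D := D.erase γ)
    (hD.mono (by exact_mod_cast Finset.erase_subset γ D))
  have h3 : commonKer P (D.erase γ : Finset ι) = commonKer P D := by
    ext h
    simp only [mem_commonKer, SetLike.mem_coe, Finset.mem_erase, and_imp]
    refine ⟨fun hh δ hδ => ?_, fun hh δ _ hδ => hh δ hδ⟩
    by_cases he : δ = γ
    · exact he ▸ hno h fun ε hε hne => hh ε hne hε
    · exact hh δ he hδ
  rw [h3] at h2
  have := Finset.card_erase_lt_of_mem hγ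
  omega

variable [P.IsCrystallographic] [P.IsReduced] [P.IsRootSystem]

/-- The roots of a subsystem of type `A₁ × ⋯ × A₁`. -/
def signedRoots (P : RootPairing ι k M N) (S : Finset ι) : Set ι :=
  {α | ∃ s ∈ S, P.root α = P.root s ∨ P.root α = -P.root s}

theorem signedRoots_add_ne (b : P.Base) {S : Finset ι} (hS : S ⊆ b.support)
    (hor : ∀ s ∈ S, ∀ t ∈ S, s ≠ t → P.pairingIn ℤ s t = 0) {α β : ι}
    (hα : α ∈ signedRoots P S) (hβ : β ∈ signedRoots P S) (m : ι) :
    P.root m ≠ P.root α + P.root β := by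
  have hsub : ∀ s ∈ S, ∀ t ∈ S, ∀ m, P.root m ≠ P.root s - P.root t := by
    intro s hs t ht m hm
    exact b.sub_notMem_range_root (hS hs) (hS ht) ⟨m, hm⟩
  have hadd : ∀ s ∈ S, ∀ t ∈ S, ∀ m, P.root m ≠ P.root s + P.root t := by
    intro s hs t ht m hm
    by_cases he : s = t
    · exact root_ne_add_self _ m (he ▸ hm)
    · obtain ⟨m', hm'⟩ := exists_root_eq_sub_of_pairingIn_eq_zero (hor s hs t ht he) hm
      exact hsub s hs t ht m' hm'
  obtain ⟨s, hs, hs'⟩ := hα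
  obtain ⟨t, ht, ht'⟩ := hβ
  intro hm
  obtain ⟨m', hm'⟩ := P.exists_root_eq_neg m
  rcases hs' with h1 | h1 <;> rcases ht' with h2 | h2 <;> rw [h1, h2] at hm
  · exact hadd s hs t ht m hm
  · exact hsub s hs t ht m (by rw [hm, sub_eq_add_neg])
  · exact hsub t ht s hs m (by rw [hm]; abel)
  · exact hadd s hs t ht m' (by rw [hm', hm]; abel)

theorem isClosedSubsystem_signedRoots (b : P.Base) {S : Finset ι} (hS : S ⊆ b.support)
    (hor : ∀ s ∈ S, ∀ t ∈ S, s ≠ t → P.pairingIn ℤ s t = 0) :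
    P.IsClosedSubsystem (signedRoots P S) where
  add hα hβ hl := absurd hl (signedRoots_add_ne b hS hor hα hβ _)
  neg := by
    rintro α β ⟨s, hs, h | h⟩ hβ
    · exact ⟨s, hs, .inr (by rw [hβ, h])⟩
    · exact ⟨s, hs, .inl (by rw [hβ, h, neg_neg])⟩

theorem isFace_signedRoots (b : P.Base) {S : Finset ι} (hS : S ⊆ b.support) :
    P.IsFace b.height (signedRoots P S) := by
  rintro i j l hi hj hl ⟨s, hs, h⟩
  have h1 := b.isHeight.add hl
  have h2 : b.height s = 1 := b.height_one_of_mem_support (hS hs)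
  rcases h with h | h
  · rw [P.root.injective h] at h1
    omega
  · have := b.isHeight.neg h
    omega

/-- `Y` carries the cascade `l` with its first `finrank k N - i` members dropped. The Cartan part
contributes `finrank k N - l.length`, and each surviving member contributes one dimension. -/
theorem exists_index_eq_of_finrank_le (b : P.Base) (c : RootCoordinates P L) {l : List ι}
    (hl : P.IsCascade b.height Set.univ l) (hli : LinearIndepOn k P.root l.toFinset) {i : ℕ}
    (hi : i ≤ finrank k N) (hli' : finrank k N ≤ i + l.length) :
    ∃ Y, P.IsClosedSubsystem Y ∧ P.IsFace b.height Y ∧ ∀ p : LieSubalgebra k L,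
      p.toSubmodule = c.subspace ∅ ({α | 0 < b.height α} ∪ {α | α ∈ Y ∧ b.height α < 0}) →
      index k p = i := by
  obtain ⟨Y, hY, hf, hl'⟩ := hl.exists_drop isClosedSubsystem_univ b.isHeight isFace_univ
    (finrank k N - i)
  refine ⟨Y, hY, hf, fun p hp => ?_⟩
  have hl₂ := hl'.map_neg hY b.isHeight
  set l₂ := (l.drop (finrank k N - i)).map fun i => P.reflectionPerm i i with hl₂_def
  have hneg : ∀ i, P.reflectionPerm (P.reflectionPerm i i) (P.reflectionPerm i i) = i := fun i =>
    P.root.injective (by rw [root_reflectionPerm_self, root_reflectionPerm_self, neg_neg])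
  have hmem : ∀ δ ∈ l₂, P.reflectionPerm δ δ ∈ l := by
    intro δ hδ
    obtain ⟨γ, hγ, rfl⟩ := List.mem_map.mp hδ
    rw [hneg]
    exact List.mem_of_mem_drop hγ
  rw [index_eq_of_cascades (C := l₂.toFinset) b.isHeight hY hl hl₂
    (fun δ hδ => ⟨List.mem_toFinset.mp hδ, hmem δ (List.mem_toFinset.mp hδ)⟩)
    (fun γ hγ hγ' => absurd (List.mem_toFinset.mpr hγ) hγ') hp, finrank_subspace]
  have h1 := finrank_commonKer_add hli
  have h2 : commonKer P (l ++ l₂).toFinset = commonKer P l.toFinset := by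
    ext h
    simp only [mem_commonKer, SetLike.mem_coe, List.mem_toFinset, List.mem_append]
    refine ⟨fun hh δ hδ => hh δ (.inl hδ), fun hh δ hδ => ?_⟩
    rcases hδ with hδ | hδ
    · exact hh δ hδ
    · have := hh _ (hmem δ hδ)
      rwa [root'_reflectionPerm_self, neg_eq_zero] at this
  have h3 := List.toFinset_card_of_nodup hl.nodup
  have h4 := List.toFinset_card_of_nodup hl₂.nodup
  rw [hl₂_def, List.length_map, List.length_drop, ← hl₂_def] at h4
  rw [h2]
  omega

/-- In the subsystem `±S` no two roots sum to a root, so the second cascade consists of the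
negatives of `S`. Each of them cuts the Cartan part by one dimension, and no root line survives. -/
theorem exists_index_eq_of_lt_finrank (b : P.Base) (c : RootCoordinates P L) {l : List ι}
    (hl : P.IsCascade b.height Set.univ l) {S : Finset ι} (hS : S ⊆ b.support)
    (hor : ∀ s ∈ S, ∀ t ∈ S, s ≠ t → P.pairingIn ℤ s t = 0) (hSl : ∀ s ∈ S, s ∉ l)
    (hli : LinearIndepOn k P.root (l.toFinset ∪ S : Finset ι)) {i : ℕ}
    (hi : i + (S.card + l.length) = finrank k N) :
    ∃ Y, P.IsClosedSubsystem Y ∧ P.IsFace b.height Y ∧ ∀ p : LieSubalgebra k L,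
      p.toSubmodule = c.subspace ∅ ({α | 0 < b.height α} ∪ {α | α ∈ Y ∧ b.height α < 0}) →
      index k p = i := by
  have hY := isClosedSubsystem_signedRoots b hS hor
  refine ⟨signedRoots P S, hY, isFace_signedRoots b hS, fun p hp => ?_⟩
  obtain ⟨l₂, hl₂⟩ := P.exists_isCascade (-b.height) (signedRoots P S)
  have hh1 : ∀ s ∈ S, b.height s = 1 := fun s hs => b.height_one_of_mem_support (hS hs)
  have hmem₁ : ∀ γ ∈ l₂, ∃ s ∈ S, P.root γ = -P.root s := by
    intro γ hγ
    have hpos := hl₂.pos_of_mem γ hγ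
    obtain ⟨s, hs, h | h⟩ := hl₂.mem_of_mem γ hγ
    · have := hh1 s hs
      rw [Pi.neg_apply, P.root.injective h] at hpos
      omega
    · exact ⟨s, hs, h⟩
  have hmem₂ : ∀ s ∈ S, P.reflectionPerm s s ∈ l₂ := by
    intro s hs
    have h1 := b.isHeight.neg (root_reflectionPerm_self P s)
    have h2 := hh1 s hs
    have h3 : P.reflectionPerm s s ∈ signedRoots P S :=
      ⟨s, hs, .inr (root_reflectionPerm_self P s)⟩
    obtain ⟨γ, hγ, h | ⟨β, hβ, -, h⟩⟩ := hl₂.exists_mem_eq_or_add hY b.isHeight.neg_height h3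
      (by rw [Pi.neg_apply]; omega)
    · rwa [h]
    · exact absurd h (signedRoots_add_ne b hS hor h3 hβ γ)
  have hroot' : ∀ {γ s}, P.root γ = -P.root s → ∀ h, P.root' γ h = -P.root' s h := by
    intro γ s hγ h
    rw [← root'_reflectionPerm_self, ← root_reflectionPerm_self] at *
    rw [P.root.injective hγ]
  have hcard : (l.toFinset ∪ S).card = l.length + S.card := by
    rw [Finset.card_union_of_disjoint, List.toFinset_card_of_nodup hl.nodup]
    rw [Finset.disjoint_left]
    exact fun s hs hs' => hSl s hs' (List.mem_toFinset.mp hs)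
  rw [index_eq_of_cascades (C := ∅) b.isHeight hY hl hl₂ (by simp) ?_ hp, finrank_subspace]
  · have h1 := finrank_commonKer_add hli
    have h2 : commonKer P (l ++ l₂).toFinset = commonKer P (l.toFinset ∪ S : Finset ι) := by
      ext h
      simp only [mem_commonKer, SetLike.mem_coe, List.mem_toFinset, List.mem_append,
        Finset.mem_union]
      constructor
      · rintro hh δ (hδ | hδ)
        · exact hh δ (.inl hδ)
        · have := hh _ (.inr (hmem₂ δ hδ))
          rwa [root'_reflectionPerm_self, neg_eq_zero] at this
      · rintro hh δ (hδ | hδ)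
        · exact hh δ (.inl hδ)
        · obtain ⟨s, hs, h'⟩ := hmem₁ δ hδ
          rw [hroot' h', hh s (.inr hs), neg_zero]
    rw [h2, Finset.card_empty]
    omega
  · intro γ hγ _
    obtain ⟨s, hs, h⟩ := hmem₁ γ hγ
    obtain ⟨x, hx, hne⟩ := exists_root'_ne_zero hli (Finset.mem_union_right _ hs)
    refine ⟨x, fun δ hδ => hx δ (Finset.mem_union_left _ (List.mem_toFinset.mpr hδ)) ?_,
      fun δ hδ hne' => ?_, by rwa [hroot' h, neg_ne_zero]⟩
    · rintro rfl
      exact hSl _ hs hδ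
    · obtain ⟨t, ht, h'⟩ := hmem₁ δ hδ
      rw [hroot' h', hx t (Finset.mem_union_right _ ht), neg_zero]
      rintro rfl
      exact hne' (P.root.injective (h'.trans h.symm))

theorem exists_index_eq (b : P.Base) (c : RootCoordinates P L) {i : ℕ} (hi : i ≤ finrank k N) :
    ∃ Y, P.IsClosedSubsystem Y ∧ P.IsFace b.height Y ∧ ∀ p : LieSubalgebra k L,
      p.toSubmodule = c.subspace ∅ ({α | 0 < b.height α} ∪ {α | α ∈ Y ∧ b.height α < 0}) →
      index k p = i := by
  obtain ⟨l, hl⟩ := P.exists_isCascade b.height Set.univ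
  obtain ⟨S, hS, -, hor, -, hSl, hli, hcard⟩ := b.exists_sparse hl isClosedSubsystem_univ isFace_univ
  have hN : b.support.card = finrank k N := by
    rw [finrank_eq_card_basis b.toCoweightBasis]
    simp
  have hN' : {s | s ∈ b.support ∧ s ∈ (Set.univ : Set ι)}.ncard = b.support.card := by
    simp [Set.ncard_coe_finset]
  rw [hN', hN] at hcard
  by_cases h : finrank k N ≤ i + l.length
  · exact exists_index_eq_of_finrank_le b c hl (hli.mono (by
      intro γ hγ
      exact .inl (by simpa using hγ))) hi h
  -- The full `S` would give index zero; each element left out raises the index by one.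
  · obtain ⟨T, hTS, hT⟩ := Finset.exists_subset_card_eq (s := S) (n := S.card - i) (by omega)
    exact exists_index_eq_of_lt_finrank b c hl (hTS.trans hS)
      (fun s hs t ht => hor s (hTS hs) t (hTS ht)) (fun s hs => hSl s (hTS hs))
      (hli.mono (by
        intro γ hγ
        rcases Finset.mem_union.mp hγ with hγ | hγ
        · exact .inl (by simpa using hγ)
        · exact .inr (hTS hγ))) (by omega)

end RootCoordinates

end LieIndex

/-! ### Root coordinates of a Killing Lie algebra. -/

namespace LieIndex

open Module LieModule LieAlgebra LieAlgebra.IsKilling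

variable {k L : Type*} [Field k] [CharZero k] [LieRing L] [LieAlgebra k L]
  [FiniteDimensional k L] [IsKilling k L] {H : LieSubalgebra k L} [H.IsCartanSubalgebra]
  [IsTriangularizable k H L]

theorem exists_smul_eq_of_mem_rootSpace {α : Weight k H L} (hα : α.IsNonZero) {x y : L}
    (hx : x ∈ rootSpace H α) (hx0 : x ≠ 0) (hy : y ∈ rootSpace H α) : ∃ c : k, c • x = y := by
  simpa using (finrank_eq_one_iff_of_nonzero' (⟨x, hx⟩ : rootSpace H α) (by simpa using hx0)).mp
    (finrank_rootSpace_eq_one α hα) ⟨y, hy⟩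

/-- Root spaces being lines, it suffices to test `e` on the vector of weight `β` obtained by
lowering a top vector `z` of the `α`-chain `n + 1` times. By `sl₂` theory the result is `(n + 1) *
(chainLength - n)` times the vector lowered `n` times, and this is nonzero because `n <
chainLength`. -/
theorem lie_ne_zero_of_mem_rootSpace {α β : Weight k H L} (hα : α.IsNonZero) (hβ : β.IsNonZero)
    (hαβ : rootSpace H (α + β : H → k) ≠ ⊥) {x y : L} (hx : x ∈ rootSpace H α) (hx0 : x ≠ 0)
    (hy : y ∈ rootSpace H β) (hy0 : y ≠ 0) : ⁅x, y⁆ ≠ 0 := by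
  obtain ⟨z, hz, z0⟩ := (chainTop α β).exists_ne_zero
  obtain ⟨h, e, f, isSl2, he, hf⟩ := exists_isSl2Triple_of_weight_isNonZero hα
  obtain rfl := isSl2.h_eq_coroot hα he hf
  have prim : isSl2.HasPrimitiveVectorWith z (chainLength α β : k) :=
    have := lie_mem_genWeightSpace_of_mem_genWeightSpace he hz
    ⟨z0, (chainLength_smul _ _ hz).symm, by rwa [genWeightSpace_add_chainTop _ _ hα] at this⟩
  have h1 := ((rootSpace_zsmul_add_ne_bot_iff α β hα 1).mp (by rwa [one_zsmul])).1
  have h2 := chainTopCoeff_le_chainLength α β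
  obtain ⟨n, hn⟩ : ∃ n, chainTopCoeff (α : H → k) β = n + 1 := ⟨chainTopCoeff (α : H → k) β - 1, by omega⟩
  have hw := toEnd_pow_apply_mem hf hz (n + 1)
  rw [coe_chainTop', hn, smul_neg, neg_add_cancel_left] at hw
  have hne := prim.lie_e_pow_succ_toEnd_f n
  obtain ⟨c, hc⟩ := exists_smul_eq_of_mem_rootSpace hα hx hx0 he
  obtain ⟨d, hd⟩ := exists_smul_eq_of_mem_rootSpace hβ hy hy0 hw
  intro h0
  rw [← hd, ← hc, lie_smul, smul_lie, h0, smul_zero, smul_zero, eq_comm, smul_eq_zero] at hne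
  rcases hne with h | h
  · have h3 : (chainLength α β : k) - n = ((chainLength α β - n : ℕ) : k) := by
      rw [Nat.cast_sub (by omega)]
    rw [h3] at h
    have : (n + 1) * (chainLength α β - n) = 0 := by exact_mod_cast h
    have : chainLength α β - n = 0 := by simpa using this
    omega
  · exact prim.pow_toEnd_f_ne_zero_of_eq_nat rfl (by omega) h

/-- A nonzero vector of a root space. -/
noncomputable def rootVec (α : Weight k H L) : L := α.exists_ne_zero.choose

theorem rootVec_mem (α : Weight k H L) : rootVec α ∈ rootSpace H α :=
  α.exists_ne_zero.choose_spec.1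

theorem rootVec_ne_zero (α : Weight k H L) : rootVec α ≠ 0 := α.exists_ne_zero.choose_spec.2

theorem killingForm_rootVec_eq_zero {α : Weight k H L} {χ : H → k} {x : L}
    (hx : x ∈ rootSpace H χ) (h : χ + α ≠ 0) : killingForm k L x (rootVec α) = 0 :=
  killingForm_apply_eq_zero_of_mem_rootSpace_of_add_ne_zero k L H hx (rootVec_mem α) h

theorem killingForm_rootVec_neg_ne_zero {α : Weight k H L} (hα : α.IsNonZero) :
    killingForm k L (rootVec α) (rootVec (-α)) ≠ 0 := by
  intro h0
  have := mem_ker_killingForm_of_mem_rootSpace_of_forall_rootSpace_neg k L H (rootVec_mem α)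
    fun y hy => by
      obtain ⟨c, rfl⟩ := exists_smul_eq_of_mem_rootSpace (Weight.IsNonZero.neg hα) (rootVec_mem _)
        (rootVec_ne_zero _) hy
      rw [map_smul, h0, smul_zero]
  rw [ker_killingForm_eq_bot] at this
  exact rootVec_ne_zero α this

/-- The coefficient of `rootVec α` in a vector. -/
noncomputable def rootCoord (α : Weight k H L) : Dual k L :=
  (killingForm k L (rootVec α) (rootVec (-α)))⁻¹ • (killingForm k L).flip (rootVec (-α))

theorem rootCoord_apply (α : Weight k H L) (x : L) : rootCoord α x =
    (killingForm k L (rootVec α) (rootVec (-α)))⁻¹ * killingForm k L x (rootVec (-α)) := rfl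

theorem rootCoord_rootVec {α : Weight k H L} (hα : α.IsNonZero) : rootCoord α (rootVec α) = 1 :=
  inv_mul_cancel₀ (killingForm_rootVec_neg_ne_zero hα)

theorem rootCoord_eq_zero {α : Weight k H L} {χ : H → k} {x : L} (hx : x ∈ rootSpace H χ)
    (h : χ ≠ α) : rootCoord α x = 0 := by
  rw [rootCoord_apply, killingForm_rootVec_eq_zero hx, mul_zero]
  rwa [Weight.coe_neg, ← sub_eq_add_neg, sub_ne_zero]

variable (H) in
/-- The Killing-orthogonal projection to a Cartan subalgebra. -/
noncomputable def cartanProj : L →ₗ[k] H :=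
  (cartanEquivDual H).symm.toLinearMap ∘ₗ H.toSubmodule.subtype.dualMap ∘ₗ killingForm k L

theorem cartanProj_eq_iff {x : L} {h : H} :
    cartanProj H x = h ↔ ∀ h' : H, killingForm k L x h' = killingForm k L h h' := by
  rw [cartanProj, LinearMap.comp_apply, LinearEquiv.coe_coe, LinearEquiv.symm_apply_eq]
  exact ⟨fun h h' => LinearMap.congr_fun h h', fun h => LinearMap.ext h⟩

theorem cartanProj_coe (h : H) : cartanProj H (h : L) = h := cartanProj_eq_iff.mpr fun _ => rfl

theorem mem_rootSpace_zero (h : H) : (h : L) ∈ rootSpace H (0 : H → k) := by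
  rw [rootSpace_zero_eq]
  exact h.2

theorem cartanProj_eq_zero {χ : H → k} (hχ : χ ≠ 0) {x : L} (hx : x ∈ rootSpace H χ) :
    cartanProj H x = 0 := by
  refine cartanProj_eq_iff.mpr fun h => ?_
  rw [killingForm_apply_eq_zero_of_mem_rootSpace_of_add_ne_zero k L H hx (mem_rootSpace_zero h)
    (by rwa [add_zero])]
  simp

theorem root_eq_add_iff (i j l : H.root) :
    (rootSystem H).root l = (rootSystem H).root i + (rootSystem H).root j ↔
      ((i : Weight k H L) + (j : Weight k H L) : H → k) = (l : Weight k H L) :=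
  ⟨fun h => funext fun x => (LinearMap.congr_fun h x).symm,
    fun h => LinearMap.ext fun x => (congrFun h x).symm⟩

theorem root_add_eq_zero_iff (i j : H.root) :
    (rootSystem H).root i + (rootSystem H).root j = 0 ↔
      ((i : Weight k H L) + (j : Weight k H L) : H → k) = 0 :=
  ⟨fun h => funext fun x => LinearMap.congr_fun h x,
    fun h => LinearMap.ext fun x => congrFun h x⟩

theorem lie_rootVec_mem (α β : Weight k H L) :
    ⁅rootVec α, rootVec β⁆ ∈ rootSpace H (α + β : H → k) :=
  lie_mem_genWeightSpace_of_mem_genWeightSpace (rootVec_mem α) (rootVec_mem β)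

theorem expand_rootVec (x : L) :
    (cartanProj H x : L) + ∑ α : H.root, rootCoord (α : Weight k H L) x • rootVec α.1 = x := by
  have hx : x ∈ ⨆ χ : Weight k H L, rootSpace H χ := by
    rw [iSup_genWeightSpace_eq_top' k H L]
    trivial
  induction hx using LieSubmodule.iSup_induction' with
  | mem χ x hx =>
    by_cases hχ : χ.IsZero
    · rw [hχ.eq, rootSpace_zero_eq] at hx
      lift x to H using hx
      rw [cartanProj_coe, Finset.sum_eq_zero, add_zero]
      intro α _
      rw [rootCoord_eq_zero (mem_rootSpace_zero x), zero_smul]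
      exact fun h => H.isNonZero_coe_root α h.symm
    · obtain ⟨c, rfl⟩ := exists_smul_eq_of_mem_rootSpace hχ (rootVec_mem χ) (rootVec_ne_zero χ) hx
      rw [cartanProj_eq_zero hχ hx, Finset.sum_eq_single ⟨χ, by simpa using hχ⟩]
      · simp [rootCoord_rootVec hχ]
      · intro α _ hne
        rw [rootCoord_eq_zero hx, zero_smul]
        exact fun h => hne (Subtype.ext (DFunLike.coe_injective h.symm))
      · simp
  | zero => simp
  | add x y _ _ hx hy =>
    conv_rhs => rw [← hx, ← hy]
    simp only [map_add, add_smul, Finset.sum_add_distrib, AddMemClass.coe_add]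
    abel

variable (H) in
/-- The root space decomposition. -/
noncomputable def rootCoordinates : RootCoordinates (rootSystem H) L where
  cartan := H.toSubmodule.subtype
  proj := cartanProj H
  vec α := rootVec α.1
  coord α := rootCoord α.1
  form := killingForm k L
  expand := expand_rootVec
  proj_cartan := cartanProj_coe
  proj_vec α := cartanProj_eq_zero (H.isNonZero_coe_root α) (rootVec_mem α.1)
  coord_cartan α h := rootCoord_eq_zero (mem_rootSpace_zero h)
    fun h => H.isNonZero_coe_root α h.symm
  coord_vec_self α := rootCoord_rootVec (H.isNonZero_coe_root α)
  coord_vec_of_ne α β h := rootCoord_eq_zero (rootVec_mem β.1)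
    fun h' => h (Subtype.ext (DFunLike.coe_injective h'.symm))
  lie_cartan_cartan h h' := congrArg Subtype.val (trivial_lie_zero H H h h')
  lie_cartan_vec h α := lie_eq_smul_of_mem_rootSpace (rootVec_mem α.1) h
  coord_lie_vec i j l := by
    rw [root_eq_add_iff]
    refine ⟨not_imp_comm.mp (rootCoord_eq_zero (lie_rootVec_mem _ _)), fun h => ?_⟩
    have hmem := lie_rootVec_mem (i : Weight k H L) j
    have hne := lie_ne_zero_of_mem_rootSpace (H.isNonZero_coe_root i) (H.isNonZero_coe_root j)
      (by rw [h]; exact l.1.genWeightSpace_ne_bot) (rootVec_mem i.1) (rootVec_ne_zero _)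
      (rootVec_mem j.1) (rootVec_ne_zero _)
    rw [h] at hmem
    obtain ⟨c, hc⟩ := exists_smul_eq_of_mem_rootSpace (H.isNonZero_coe_root l) (rootVec_mem l.1)
      (rootVec_ne_zero _) hmem
    rw [← hc] at hne ⊢
    rw [map_smul, rootCoord_rootVec (H.isNonZero_coe_root l), smul_eq_mul, mul_one]
    rintro rfl
    exact hne (zero_smul _ _)
  lie_vec_vec i j h0 hno := by
    have hmem := lie_rootVec_mem (i : Weight k H L) j
    by_contra hne
    let l : Weight k H L := ⟨(i.1 + j.1 : H → k), fun h => hne (by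
      rw [rootSpace, h] at hmem
      exact hmem)⟩
    have hl : l.IsNonZero := fun h => h0 ((root_add_eq_zero_iff i j).mpr h)
    exact hno ⟨l, by simpa using hl⟩ ((root_eq_add_iff i j _).mpr rfl)
  form_symm := LieModule.traceForm_comm k L L
  form_lie := LieModule.traceForm_apply_lie_apply k L L
  form_cartan_vec h α := killingForm_rootVec_eq_zero (mem_rootSpace_zero h)
    (by rw [zero_add]; exact H.isNonZero_coe_root α)
  form_vec_vec i j := by
    rw [root_add_eq_zero_iff]
    refine ⟨not_imp_comm.mp (killingForm_rootVec_eq_zero (rootVec_mem _)), fun h => ?_⟩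
    have : (j : Weight k H L) = -i :=
      DFunLike.coe_injective (eq_neg_of_add_eq_zero_right h)
    rw [this]
    exact killingForm_rootVec_neg_ne_zero (H.isNonZero_coe_root i)
  form_cartan_coroot h α hα := by
    have := traceForm_coroot (α : Weight k H L) h
    rw [LieModule.traceForm_comm] at this
    refine this.trans ?_
    have h0 : (α : Weight k H L) h = 0 := hα
    rw [h0]
    simp
  form_cartan_nondegenerate h hh :=
    (cartanEquivDual H).map_eq_zero_iff.mp (LinearMap.ext hh)

end LieIndex

/-! ### Parabolic subalgebras, a Cartan subalgebra of dimension `ℓ`, and the conclusion. -/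

namespace LieIndex

open Module LieModule LieAlgebra LieAlgebra.IsKilling RootPairing

namespace RootCoordinates

variable {ι k M N L : Type*} [Fintype ι] [Field k] [CharZero k] [AddCommGroup M] [Module k M]
  [AddCommGroup N] [Module k N] [LieRing L] [LieAlgebra k L] {P : RootPairing ι k M N}

/-- The subalgebra spanned by the Cartan part and the root vectors of a closed set of roots. -/
def subalgebra (c : RootCoordinates P L) (A : Set ι)
    (hA : ∀ i ∈ A, ∀ j ∈ A, ∀ l, P.root l = P.root i + P.root j → l ∈ A) : LieSubalgebra k L where
  __ := c.subspace ∅ A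
  lie_mem' {x y} hx hy := by
    refine ⟨fun _ h => h.elim, fun γ hγ => ?_⟩
    rw [c.coord_lie, hx.2 γ hγ, hy.2 γ hγ, mul_zero, mul_zero, sub_zero, zero_add]
    refine Finset.sum_eq_zero fun i _ => Finset.sum_eq_zero fun j _ => ?_
    by_cases hi : c.coord i x = 0
    · rw [hi, zero_mul]
    by_cases hj : c.coord j y = 0
    · rw [hj, zero_mul, mul_zero]
    rw [coord_lie_eq_zero_of_ne, mul_zero, mul_zero]
    exact fun h => hγ (hA i (by_contra fun h => hi (hx.2 i h)) j (by_contra fun h => hj (hy.2 j h))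
      γ h)

/-- The only delicate case is `i` positive, `j ∈ Y` negative and `l = i + j` negative. Then `-j = i
+ (-l)` shows `-l` to be a positive summand of an element of `Y`, so the face property applies. -/
theorem _root_.RootPairing.IsFace.mem_union_of_root_eq_add {ht : ι → ℤ} {Y : Set ι}
    (h : P.IsHeight ht) (hY : P.IsClosedSubsystem Y) (hf : P.IsFace ht Y) :
    ∀ i ∈ {α | 0 < ht α} ∪ {α | α ∈ Y ∧ ht α < 0}, ∀ j ∈ {α | 0 < ht α} ∪ {α | α ∈ Y ∧ ht α < 0},
      ∀ l, P.root l = P.root i + P.root j → l ∈ {α | 0 < ht α} ∪ {α | α ∈ Y ∧ ht α < 0} := by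
  have key : ∀ i j l, 0 < ht i → j ∈ Y → ht j < 0 → P.root l = P.root i + P.root j →
      l ∈ {α | 0 < ht α} ∪ {α | α ∈ Y ∧ ht α < 0} := by
    intro i j l hi hj hj0 hl
    rcases (h.ne_zero l).lt_or_gt with hl0 | hl0
    · obtain ⟨j', hj'⟩ := P.exists_root_eq_neg j
      obtain ⟨l', hl'⟩ := P.exists_root_eq_neg l
      have h1 := h.neg hj'
      have h2 := h.neg hl'
      have h3 : l' ∈ Y := hf (j := i) (by omega) hi (by rw [hj', hl', hl]; abel) (hY.neg hj hj')
      exact .inr ⟨hY.neg h3 (by rw [hl', neg_neg]), hl0⟩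
    · exact .inl hl0
  rintro i (hi | ⟨hi, hi0⟩) j (hj | ⟨hj, hj0⟩) l hl
  · refine .inl ?_
    have := h.add hl
    rw [Set.mem_ofPred_eq] at *
    omega
  · exact key i j l hi hj hj0 hl
  · exact key j i l hj hi hi0 (by rw [hl, add_comm])
  · refine .inr ⟨hY.add hi hj hl, ?_⟩
    have := h.add hl
    omega

end RootCoordinates

section Killing

variable {k L : Type*} [Field k] [CharZero k] [LieRing L] [LieAlgebra k L]
  [FiniteDimensional k L]

/-- The Engel subalgebra of a regular element has dimension equal to the rank, the least possible
for an Engel subalgebra. It is therefore minimal among those of its own elements, and so nilpotent.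
-/
theorem exists_isCartanSubalgebra_finrank_eq_rank (k L : Type*) [Field k] [CharZero k] [LieRing L]
    [LieAlgebra k L] [FiniteDimensional k L] :
    ∃ H : LieSubalgebra k L, H.IsCartanSubalgebra ∧ finrank k H = LieAlgebra.rank k L := by
  obtain ⟨x, hx⟩ := LieAlgebra.exists_isRegular k L
  have hrank := (LieAlgebra.isRegular_iff_finrank_engel_eq_rank k x).mp hx
  have hcard : (finrank k L : Cardinal) ≤ Cardinal.mk k :=
    Cardinal.natCast_le_aleph0.trans (Cardinal.infinite_iff.mp inferInstance)
  refine ⟨LieSubalgebra.engel k x, ⟨?_, LieSubalgebra.normalizer_engel _ _⟩, hrank⟩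
  refine LieSubalgebra.isNilpotent_of_forall_le_engel _ fun y hy => ?_
  set E : {LieSubalgebra.engel k z | z ∈ LieSubalgebra.engel k x} :=
    ⟨LieSubalgebra.engel k x, x, LieSubalgebra.self_mem_engel _ _, rfl⟩
  suffices IsBot E from @this ⟨LieSubalgebra.engel k y, y, hy, rfl⟩
  refine engel_isBot_of_isMin hcard (LieSubalgebra.engel k x) E le_rfl ?_
  rintro ⟨_, y, hy, rfl⟩ hyx
  refine (LieSubalgebra.toSubmodule_injective
    (Submodule.eq_of_le_of_finrank_le hyx ?_) : LieSubalgebra.engel k y = _).ge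
  exact hrank.le.trans (LieAlgebra.rank_le_finrank_engel k y)

variable [IsKilling k L] {H : LieSubalgebra k L} [H.IsCartanSubalgebra] [IsTriangularizable k H L]

theorem subspace_eq_sup (A : Set H.root) : (rootCoordinates H).subspace ∅ A =
    H.toSubmodule ⊔ ⨆ (α : H.root) (_ : α ∈ A),
      (rootSpace H (α : Weight k H L)).toSubmodule := by
  refine le_antisymm (fun x hx => ?_) (sup_le (fun x hx => ?_) (iSup₂_le fun α hα x hx => ?_))
  · rw [← (rootCoordinates H).expand x]
    refine add_mem (Submodule.mem_sup_left ((rootCoordinates H).proj x).2)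
      (Submodule.mem_sup_right (sum_mem fun α _ => ?_))
    by_cases hα : α ∈ A
    · exact Submodule.mem_iSup_of_mem α (Submodule.mem_iSup_of_mem hα
        (Submodule.smul_mem _ _ (rootVec_mem α.1)))
    · rw [hx.2 α hα, zero_smul]
      exact zero_mem _
  · exact RootCoordinates.cartan_mem_subspace (c := rootCoordinates H) (h := ⟨x, hx⟩)
      fun _ h => h.elim
  · obtain ⟨r, rfl⟩ := exists_smul_eq_of_mem_rootSpace (H.isNonZero_coe_root α) (rootVec_mem α.1)
      (rootVec_ne_zero _) hx
    exact Submodule.smul_mem _ _ (RootCoordinates.vec_mem_subspace (c := rootCoordinates H) hα)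

end Killing

end LieIndex

theorem mainTheorem3 {k L : Type*} [Field k] [CharZero k] [IsAlgClosed k]
    [LieRing L] [LieAlgebra k L] [FiniteDimensional k L] [LieAlgebra.IsSemisimple k L]
    (i : ℕ) (hi : i ≤ LieAlgebra.rank k L) :
    ∃ p : LieSubalgebra k L, LieIndex.IsParabolic p ∧ LieIndex.index k p = i := by
  classical
  obtain ⟨H, hH, hrank⟩ := LieIndex.exists_isCartanSubalgebra_finrank_eq_rank k L
  obtain ⟨b⟩ := (LieAlgebra.IsKilling.rootSystem H).nonempty_base
  obtain ⟨Y, hY, hf, h⟩ := LieIndex.RootCoordinates.exists_index_eq b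
    (LieIndex.rootCoordinates H) (hi.trans hrank.ge)
  refine ⟨(LieIndex.rootCoordinates H).subalgebra _
    (RootPairing.IsFace.mem_union_of_root_eq_add b.isHeight hY hf),
    ⟨(LieIndex.rootCoordinates H).subalgebra {α | b.IsPos α}
      fun α hα β hβ γ hγ => hα.add hβ hγ, ⟨H, hH, b, LieIndex.subspace_eq_sup _⟩, ?_⟩, h _ rfl⟩
  exact fun x hx => ⟨fun _ h => h.elim, fun α hα => hx.2 α fun h => hα (.inl h)⟩
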